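/- Let $K$ be a field of characteristic $0$ and let $S=K[x_1,\ldots,x_n,y_1,\ldots,y_m]$ be bigraded by $\deg(x_i)=(1,0)$ and $\deg(y_j)=(0,1)$. For a bigraded ideal $J\subset S$ let $\beta_{i,(a,b)}(S/J)=\dim_K \operatorname{Tor}_i^S(S/J,K)_{(a,b)}$, where $K=S/(x_1,\ldots,x_n,y_1,\ldots,y_m)$, and let $$\operatorname{reg}_x(S/J)=\sup\{a\in\mathbb{Z} : \beta_{i,(a+i,b)}(S/J)\neq 0 \text{ for some } i,b\in\mathbb{Z}\},\qquad \sup\emptyset=-\infty .$$ Order the monomials of $S$ as follows: $x^uy^v>x^{u'}y^{v'}$ if $(|u|+|v|,|v|,|u|)>(|u'|+|v'|,|v'|,|u'|)$ lexicographically, or if these triples are equal and $x^uy^v>x^{u'}y^{v'}$ in the reverse lexicographic order induced by $y_1>\cdots>y_m>x_1>\cdots>x_n$. For an ideal $I\subset S$ let $\operatorname{in}(I)$ be the ideal generated by the initial monomials of the nonzero elements of $I$. An element $g=((d_{ij}),(e_{kl}))$ of $G=\operatorname{GL}(n,K)\times\operatorname{GL}(m,K)$ acts on $S$ by the $K$-algebra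 automorphism with $g(x_j)=\sum_i d_{ij}x_i$ and $g(y_l)=\sum_k e_{kl}y_k$. The bigeneric initial ideal $\operatorname{bigin}(J)$ is the ideal for which there is a nonempty Zariski open set $U\subset G$ with $\operatorname{in}(gJ)=\operatorname{bigin}(J)$ for all $g\in U$. Then every bigraded ideal $J\subset S$ satisfies $$\operatorname{reg}_x(S/J)=\operatorname{reg}_x(S/\operatorname{bigin}(J)).$$ -/

import Mathlib

namespace Bigraded

universe u

/-- The polynomial ring `S = K[x_1,…,x_n,y_1,…,y_m]`; the variable `x_i` is `X (Sum.inl i)` and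
`y_j` is `X (Sum.inr j)`. -/
abbrev Poly (K : Type u) [Field K] (n m : ℕ) : Type u := MvPolynomial (Fin n ⊕ Fin m) K

/-- The bidegrees of the variables: `deg x_i = (1,0)`, `deg y_j = (0,1)`. -/
def wt (n m : ℕ) : Fin n ⊕ Fin m → ℤ × ℤ := Sum.elim (fun _ => (1, 0)) (fun _ => (0, 1))

section

variable {K : Type u} [Field K] {n m : ℕ}

/-- `p` is zero or bihomogeneous of bidegree `d`. -/
def IsBihom (p : Poly K n m) (d : ℤ × ℤ) : Prop := MvPolynomial.IsWeightedHomogeneous (wt n m) p d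

/-- The bihomogeneous component of bidegree `d`. -/
noncomputable def bicomp (d : ℤ × ℤ) : Poly K n m →ₗ[K] Poly K n m :=
  MvPolynomial.weightedHomogeneousComponent (wt n m) d

/-- Bigraded ideals: closed under taking bihomogeneous components. -/
def IsBigraded (J : Ideal (Poly K n m)) : Prop := ∀ f ∈ J, ∀ d : ℤ × ℤ, bicomp d f ∈ J

/-! ### Bigraded free resolutions, `Tor`, Betti numbers and the `x`-regularity -/

/-- A bigraded resolution `⋯ → F_1 → F_0 → S/J → 0` of `S/J` by finitely generated bigraded free
modules `F_i = ⊕_k S(-deg i k)`, where the maps are homogeneous of bidegree `(0,0)`. -/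
structure FreeResolution (J : Ideal (Poly K n m)) where
  /-- the rank of `F_i` -/
  rk : ℕ → ℕ
  /-- the bidegrees of the basis elements of `F_i` -/
  deg : (i : ℕ) → Fin (rk i) → ℤ × ℤ
  /-- the matrix of `F_{i+1} → F_i` -/
  mat : (i : ℕ) → Matrix (Fin (rk i)) (Fin (rk (i + 1))) (Poly K n m)
  /-- the augmentation `F_0 → S/J` -/
  aug : (Fin (rk 0) → Poly K n m) →ₗ[Poly K n m] (Poly K n m ⧸ J)
  mat_bihom : ∀ i j k, IsBihom (mat i j k) (deg (i + 1) k - deg i j)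
  aug_bihom : ∀ j, ∃ p : Poly K n m, IsBihom p (deg 0 j) ∧
    aug (Pi.single j 1) = Ideal.Quotient.mk J p
  aug_surjective : Function.Surjective aug
  exact_zero : LinearMap.range (mat 0).mulVecLin = LinearMap.ker aug
  exact_succ : ∀ i, LinearMap.range (mat (i + 1)).mulVecLin = LinearMap.ker (mat i).mulVecLin

namespace FreeResolution

variable {J : Ideal (Poly K n m)} (F : FreeResolution J)

/-- The component of bidegree `d` of `F_i ⊗_S K`, where `K = S/(x_1,…,x_n,y_1,…,y_m)`: it has as
basis the basis elements of `F_i` of bidegree `d`. -/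
abbrev fiber (i : ℕ) (d : ℤ × ℤ) : Type u := {k : Fin (F.rk i) // F.deg i k = d} → K

/-- The component of bidegree `d` of `F_{i+1} ⊗_S K → F_i ⊗_S K`: in the matrix of `F_{i+1} → F_i`
the variables are replaced by zero. -/
noncomputable def fiberMap (i : ℕ) (d : ℤ × ℤ) : F.fiber (i + 1) d →ₗ[K] F.fiber i d :=
  Matrix.mulVecLin
    (Matrix.of fun (j : {j : Fin (F.rk i) // F.deg i j = d})
      (k : {k : Fin (F.rk (i + 1)) // F.deg (i + 1) k = d}) =>
        MvPolynomial.constantCoeff (F.mat i j.1 k.1))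

/-- The cycles of bidegree `d` of the complex `F ⊗_S K` in homological degree `i`. -/
noncomputable def cycles : (i : ℕ) → (d : ℤ × ℤ) → Submodule K (F.fiber i d)
  | 0, _ => ⊤
  | i + 1, d => LinearMap.ker (F.fiberMap i d)

/-- The boundaries of bidegree `d` of the complex `F ⊗_S K` in homological degree `i`. -/
noncomputable def boundaries (i : ℕ) (d : ℤ × ℤ) : Submodule K (F.fiber i d) :=
  LinearMap.range (F.fiberMap i d)

/-- `Tor_i^S(S/J, K)_d = H_i(F ⊗_S K)_d`. -/
abbrev Tor (i : ℕ) (d : ℤ × ℤ) : Type u :=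
  F.cycles i d ⧸ (F.boundaries i d).submoduleOf (F.cycles i d)

end FreeResolution

/-! #### Existence of bigraded free resolutions -/

lemma bicomp_mul {p : Poly K n m} {e : ℤ × ℤ} (hp : IsBihom p e) (q : Poly K n m) (d : ℤ × ℤ) :
    bicomp d (p * q) = p * bicomp (d - e) q := by
  classical
  let _ := MvPolynomial.weightedGradedAlgebra K (wt n m)
  have h := DirectSum.coe_decompose_mul_add_of_left_mem
    (MvPolynomial.weightedHomogeneousSubmodule K (wt n m)) (i := e) (j := d - e) (a := p) (b := q) hp
  erw [MvPolynomial.weightedDecomposition.decompose'_apply,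
    MvPolynomial.weightedDecomposition.decompose'_apply] at h
  rwa [add_sub_cancel] at h

/-- The component of bidegree `d` of an element of `⊕_k S(-deg k)`. -/
noncomputable def vecComp {r : ℕ} (deg : Fin r → ℤ × ℤ) (d : ℤ × ℤ) (f : Fin r → Poly K n m) :
    Fin r → Poly K n m := fun j => bicomp (d - deg j) (f j)

lemma exists_sum_vecComp {r : ℕ} (deg : Fin r → ℤ × ℤ) (f : Fin r → Poly K n m) :
    ∃ D : Finset (ℤ × ℤ), f = ∑ d ∈ D, vecComp deg d f := by
  classical
  refine ⟨Finset.univ.biUnion fun j =>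
    (f j).support.image fun u => Finsupp.weight (wt n m) u + deg j, ?_⟩
  funext j
  rw [Finset.sum_apply]
  ext u
  rw [MvPolynomial.coeff_sum]
  simp only [vecComp, bicomp, MvPolynomial.coeff_weightedHomogeneousComponent]
  by_cases hu : MvPolynomial.coeff u (f j) = 0
  · simp [hu]
  rw [Finset.sum_eq_single (Finsupp.weight (wt n m) u + deg j)]
  · simp
  · intro d _ hd
    rw [if_neg]
    rintro h
    exact hd (by rw [h]; simp)
  · intro h
    exact absurd (Finset.mem_biUnion.2 ⟨j, Finset.mem_univ _,
      Finset.mem_image.2 ⟨u, MvPolynomial.mem_support_iff.2 hu, rfl⟩⟩) h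

lemma exists_gens {r : ℕ} (deg : Fin r → ℤ × ℤ) (N : Submodule (Poly K n m) (Fin r → Poly K n m))
    (hN : ∀ f ∈ N, ∀ d, vecComp deg d f ∈ N) :
    ∃ (s : ℕ) (e : Fin s → ℤ × ℤ) (A : Matrix (Fin r) (Fin s) (Poly K n m)),
      (∀ j k, IsBihom (A j k) (e k - deg j)) ∧ LinearMap.range A.mulVecLin = N := by
  classical
  let H : Set (Fin r → Poly K n m) := {f | f ∈ N ∧ ∃ d, ∀ j, IsBihom (f j) (d - deg j)}
  have hH : Submodule.span (Poly K n m) H = N := by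
    apply le_antisymm
    · exact Submodule.span_le.2 fun f hf => hf.1
    · intro f hf
      obtain ⟨D, hD⟩ := exists_sum_vecComp deg f
      rw [hD]
      refine Submodule.sum_mem _ fun d _ => Submodule.subset_span ⟨hN f hf d, d, fun j => ?_⟩
      exact MvPolynomial.weightedHomogeneousComponent_isWeightedHomogeneous _ _
  have hfg : (Submodule.span (Poly K n m) H).FG := IsNoetherian.noetherian _
  obtain ⟨T, hTH, hT⟩ := (Submodule.fg_span_iff_fg_span_finset_subset H).1 hfg
  have hdeg : ∀ k : Fin T.card, ∃ d, ∀ j, IsBihom ((T.equivFin.symm k).1 j) (d - deg j) :=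
    fun k => (hTH (T.equivFin.symm k).2).2
  choose e he using hdeg
  refine ⟨T.card, e, Matrix.of fun j k => (T.equivFin.symm k).1 j, fun j k => he k j, ?_⟩
  rw [Matrix.range_mulVecLin, ← hH, hT]
  congr 1
  ext f
  constructor
  · rintro ⟨k, rfl⟩
    exact (T.equivFin.symm k).2
  · intro hf
    exact ⟨T.equivFin ⟨f, hf⟩, by funext j; simp [Matrix.col]⟩

lemma ker_closed {r s : ℕ} (deg : Fin r → ℤ × ℤ) (e : Fin s → ℤ × ℤ)
    (A : Matrix (Fin r) (Fin s) (Poly K n m)) (hA : ∀ j k, IsBihom (A j k) (e k - deg j)) :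
    ∀ f ∈ LinearMap.ker A.mulVecLin, ∀ d, vecComp e d f ∈ LinearMap.ker A.mulVecLin := by
  intro f hf d
  rw [LinearMap.mem_ker, Matrix.mulVecLin_apply] at hf ⊢
  funext j
  have h := congrArg (bicomp (d - deg j)) (congrFun hf j)
  simp only [Matrix.mulVec, dotProduct, map_sum, Pi.zero_apply, map_zero] at h ⊢
  rw [← h]
  refine Finset.sum_congr rfl fun k _ => ?_
  rw [bicomp_mul (hA j k), vecComp]
  congr 2
  abel_nf

/-- A bigraded free module together with a bigraded submodule. -/
structure Stage (K : Type u) [Field K] (n m : ℕ) where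
  /-- the rank -/
  r : ℕ
  /-- the bidegrees of the basis elements -/
  deg : Fin r → ℤ × ℤ
  /-- the submodule -/
  N : Submodule (Poly K n m) (Fin r → Poly K n m)
  closed : ∀ f ∈ N, ∀ d, vecComp deg d f ∈ N

lemma Stage.exists_next (s : Stage K n m) :
    ∃ (t : Stage K n m) (A : Matrix (Fin s.r) (Fin t.r) (Poly K n m)),
      (∀ j k, IsBihom (A j k) (t.deg k - s.deg j)) ∧ LinearMap.range A.mulVecLin = s.N ∧
        LinearMap.ker A.mulVecLin = t.N := by
  obtain ⟨r, e, A, hA, h⟩ := exists_gens s.deg s.N s.closed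
  exact ⟨⟨r, e, LinearMap.ker A.mulVecLin, ker_closed _ _ _ hA⟩, A, hA, h, rfl⟩

/-- Every bigraded ideal `J` has a bigraded free resolution of `S/J`. -/
theorem nonempty_freeResolution {J : Ideal (Poly K n m)} (hJ : IsBigraded J) :
    Nonempty (FreeResolution J) := by
  choose next A hA hr hk using fun s : Stage K n m => s.exists_next
  let aug : (Fin 1 → Poly K n m) →ₗ[Poly K n m] (Poly K n m ⧸ J) :=
    (Submodule.mkQ J).comp (LinearMap.proj 0)
  have haug : ∀ f, f ∈ LinearMap.ker aug ↔ f 0 ∈ J := fun f => by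
    simp [aug, Ideal.Quotient.eq_zero_iff_mem]
  let s0 : Stage K n m := ⟨1, fun _ => 0, LinearMap.ker aug, fun f hf d => by
    rw [haug] at hf ⊢
    exact hJ _ hf _⟩
  let st : ℕ → Stage K n m := fun i => Nat.rec s0 (fun _ s => next s) i
  refine ⟨⟨fun i => (st i).r, fun i => (st i).deg, fun i => A (st i), aug,
    fun i j k => hA (st i) j k, fun j => ⟨1, ?_, ?_⟩, ?_, ?_, ?_⟩⟩
  · exact MvPolynomial.isWeightedHomogeneous_one _ _
  · have : j = (0 : Fin 1) := Subsingleton.elim (α := Fin 1) _ _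
    subst this
    simp [aug]
  · intro q
    obtain ⟨p, rfl⟩ := Submodule.mkQ_surjective J q
    exact ⟨fun _ => p, rfl⟩
  · exact hr (st 0)
  · intro i
    exact (hr (st (i + 1))).trans (hk (st i)).symm

open Classical in
/-- The bigraded Betti number `β_{i,d}(S/J) = dim_K Tor_i^S(S/J, K)_d`. As usual, `Tor` is computed
from some bigraded free resolution of `S/J`; it exists for every bigraded ideal `J`
(`nonempty_freeResolution`). -/
noncomputable def betti (J : Ideal (Poly K n m)) (i : ℕ) (d : ℤ × ℤ) : ℕ :=
  if h : Nonempty (FreeResolution J) then Module.finrank K (h.some.Tor i d) else 0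

/-- The `x`-regularity `reg_x(S/J) = sup {a ∈ ℤ : β_{i,(a+i,b)}(S/J) ≠ 0 for some i, b}`, with
`sup ∅ = -∞`. -/
noncomputable def regX (J : Ideal (Poly K n m)) : WithBot (WithTop ℤ) :=
  sSup {r | ∃ a : ℤ, r = ((a : WithTop ℤ) : WithBot (WithTop ℤ)) ∧
    ∃ (i : ℕ) (b : ℤ), betti J i (a + i, b) ≠ 0}

/-! ### The bigraded reverse lexicographic order and initial ideals -/

/-- `|u|` for the exponent `(u,v)` of `x^u y^v`. -/
def xdeg (e : Fin n ⊕ Fin m →₀ ℕ) : ℕ := ∑ i, e (Sum.inl i)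

/-- `|v|` for the exponent `(u,v)` of `x^u y^v`. -/
def ydeg (e : Fin n ⊕ Fin m →₀ ℕ) : ℕ := ∑ j, e (Sum.inr j)

/-- The position of a variable in the list `y_1 > … > y_m > x_1 > … > x_n` (from `0`). -/
def pos : Fin n ⊕ Fin m → ℕ := Sum.elim (fun i => m + i) (fun j => j)

/-- `e' < e` for the reverse lexicographic order on monomials of the same degree: at the last
variable in which they differ, `e` has the smaller exponent. -/
def RevLexLT (e' e : Fin n ⊕ Fin m →₀ ℕ) : Prop :=
  ∃ k, e k < e' k ∧ ∀ l, pos k < pos l → e l = e' l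

/-- The triple `(|u|+|v|, |v|, |u|)`, to be compared lexicographically. -/
def degTriple (e : Fin n ⊕ Fin m →₀ ℕ) : ℕ ×ₗ ℕ ×ₗ ℕ :=
  toLex (xdeg e + ydeg e, toLex (ydeg e, xdeg e))

/-- `e' < e` for the bigraded reverse lexicographic order. -/
def TermLT (e' e : Fin n ⊕ Fin m →₀ ℕ) : Prop :=
  degTriple e' < degTriple e ∨ (degTriple e' = degTriple e ∧ RevLexLT e' e)

/-- `e` is the exponent of the initial monomial `in(f)` of `f ≠ 0`. -/
def IsInitialExponent (f : Poly K n m) (e : Fin n ⊕ Fin m →₀ ℕ) : Prop :=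
  e ∈ f.support ∧ ∀ e' ∈ f.support, e' ≠ e → TermLT e' e

/-- The initial ideal `in(J)`. -/
noncomputable def initialIdeal (J : Ideal (Poly K n m)) : Ideal (Poly K n m) :=
  Ideal.span {q | ∃ f ∈ J, ∃ e, IsInitialExponent f e ∧ q = MvPolynomial.monomial e 1}

/-! ### The bigeneric initial ideal -/

/-- The group `G = GL(n,K) × GL(m,K)`. -/
abbrev Grp (K : Type u) [Field K] (n m : ℕ) : Type u :=
  Matrix.GeneralLinearGroup (Fin n) K × Matrix.GeneralLinearGroup (Fin m) K

/-- For `g = (d_{ij}, e_{kl}) ∈ G` the automorphism of `S` with `g(x_j) = ∑_i d_{ij} x_i` and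
`g(y_l) = ∑_k e_{kl} y_k`. -/
noncomputable def act (g : Grp K n m) : Poly K n m →ₐ[K] Poly K n m :=
  MvPolynomial.aeval (Sum.elim
    (fun j => ∑ i, MvPolynomial.C (g.1.1 i j) * MvPolynomial.X (Sum.inl i))
    (fun l => ∑ k, MvPolynomial.C (g.2.1 k l) * MvPolynomial.X (Sum.inr k)))

/-- The entries of `g ∈ G`, as a point of the affine space of pairs of matrices. -/
def entries (g : Grp K n m) : (Fin n × Fin n) ⊕ (Fin m × Fin m) → K :=
  Sum.elim (fun ij => g.1.1 ij.1 ij.2) (fun kl => g.2.1 kl.1 kl.2)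

/-- Zariski open subsets of `G`, a subspace of the affine space of pairs of matrices: the points
where not all polynomials of some set vanish. -/
def IsZariskiOpen (U : Set (Grp K n m)) : Prop :=
  ∃ P : Set (MvPolynomial ((Fin n × Fin n) ⊕ (Fin m × Fin m)) K),
    U = {g | ∃ p ∈ P, MvPolynomial.eval (entries g) p ≠ 0}

/-- `B` is the common value of `in(gJ)` for all `g` in some nonempty Zariski open subset of `G`. -/
def IsBigin (J B : Ideal (Poly K n m)) : Prop :=
  ∃ U : Set (Grp K n m), IsZariskiOpen U ∧ U.Nonempty ∧
    ∀ g ∈ U, initialIdeal (J.map (act g)) = B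

/-- The bigeneric initial ideal `bigin(J)`: the ideal `B` with `IsBigin J B`. (For an infinite field
two nonempty Zariski open subsets of `G` meet, so that there is at most one such ideal.) -/
noncomputable def bigin (J : Ideal (Poly K n m)) : Ideal (Poly K n m) :=
  Classical.epsilon (IsBigin J)

end

end Bigraded

namespace Bigraded

universe u

variable {K : Type u} [Field K] {n m : ℕ}

/-! ### Bihomogeneous components -/

/-! The `x`-regularity can be read off from a sequence of linear forms. Let `z_0, …, z_{n+m-1}` be a
regular sequence of linear forms generating the ideal of the variables, `n` of bidegree `(1,0)`
followed by `m` of bidegree `(0,1)`, and let `Q_k = (z_0, …, z_{k-1})`. For a free resolution `F` of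
`S/J` the homology of `F/Q_kF` is `S/J` in degree 0 for `k = 0` and `Tor(S/J, K)` for `k = n + m`;
consecutive values of `k` are linked by the long exact sequence of multiplication by `z_k`. The
`jumps` are the `x`-degrees in which `S/(J + Q_n)`, or the kernel of `z_k` on `S/(J + Q_k)` for some
`k < n`, is nonzero. Increasing `k` shows that `Tor` is bounded by the jumps; decreasing `k` shows
that the largest jump occurs in `Tor`. Hence `reg_x` is the supremum of the jumps as soon as these
are bounded above (`regX_eq_sSup_jumps`), that is, as soon as the forms are almost regular.

For the sequence `x_n, …, x_1, y_1, …, y_m` the jumps of an ideal `I` depend only on the Hilbert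
functions of the ideals `I + (x_n, …, x_{n-k+1})`. In the reverse lexicographic order these do not
change when `I` is replaced by `in(I)`, so `I` and `in(I)` have the same jumps
(`jumps_initialIdeal`).

With `I = gJ`, the jumps of `gJ` are those of `J` for the forms `g⁻¹x_n, …, g⁻¹x_1` (`jumps_act`).
Some `g` in the open set defining `bigin(J)` makes them bounded, because general linear forms avoid
the associated primes of the relevant saturated ideals (`exists_bddAbove_jumps`). Then `reg_x(S/J)`
and `reg_x(S/in(gJ))` are the same supremum. That `bigin(J)` is attained on an open set at all
(`exists_isBigin`) rests on the generic constancy of ranks of matrices with polynomial entries. -/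

lemma isBihom_bicomp (d : ℤ × ℤ) (p : Poly K n m) : IsBihom (bicomp d p) d :=
  MvPolynomial.weightedHomogeneousComponent_isWeightedHomogeneous _ _

lemma IsBihom.bicomp_eq {p : Poly K n m} {d : ℤ × ℤ} (hp : IsBihom p d) : bicomp d p = p :=
  MvPolynomial.IsWeightedHomogeneous.weightedHomogeneousComponent_same hp

lemma IsBihom.sub {p q : Poly K n m} {d : ℤ × ℤ} (hp : IsBihom p d) (hq : IsBihom q d) :
    IsBihom (p - q) d :=
  MvPolynomial.IsWeightedHomogeneous.sub hp hq

lemma IsBihom.mul {p q : Poly K n m} {d e : ℤ × ℤ} (hp : IsBihom p d) (hq : IsBihom q e) :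
    IsBihom (p * q) (d + e) :=
  MvPolynomial.IsWeightedHomogeneous.mul hp hq

lemma IsBigraded.sup {I J : Ideal (Poly K n m)} (hI : IsBigraded I) (hJ : IsBigraded J) :
    IsBigraded (I ⊔ J) := by
  intro f hf d
  obtain ⟨a, ha, b, hb, rfl⟩ := Submodule.mem_sup.1 hf
  rw [map_add]
  exact Submodule.add_mem_sup (hI a ha d) (hJ b hb d)

lemma isBigraded_span_singleton {z : Poly K n m} {e : ℤ × ℤ} (hz : IsBihom z e) :
    IsBigraded (Ideal.span {z}) := by
  intro f hf d
  obtain ⟨q, rfl⟩ := Ideal.mem_span_singleton'.1 hf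
  rw [mul_comm, bicomp_mul hz]
  exact Ideal.mul_mem_right _ _ (Ideal.mem_span_singleton_self z)

lemma isBigraded_bot : IsBigraded (⊥ : Ideal (Poly K n m)) := by
  intro f hf d
  rw [Ideal.mem_bot] at hf ⊢
  rw [hf, map_zero]

/-! ### Homogeneous elements of bigraded free modules -/

/-- `f` is an element of bidegree `d` of `⊕_k S(-deg k)`. -/
def HomVec {r : ℕ} (deg : Fin r → ℤ × ℤ) (d : ℤ × ℤ) (f : Fin r → Poly K n m) : Prop :=
  ∀ j, IsBihom (f j) (d - deg j)

section HomVec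

variable {r s : ℕ} {deg : Fin r → ℤ × ℤ} {d e : ℤ × ℤ}

lemma homVec_vecComp (deg : Fin r → ℤ × ℤ) (d : ℤ × ℤ) (f : Fin r → Poly K n m) :
    HomVec deg d (vecComp deg d f) :=
  fun _ => isBihom_bicomp _ _

lemma HomVec.vecComp_eq {f : Fin r → Poly K n m} (hf : HomVec deg d f) : vecComp deg d f = f :=
  funext fun j => (hf j).bicomp_eq

lemma HomVec.sub {f g : Fin r → Poly K n m} (hf : HomVec deg d f) (hg : HomVec deg d g) :
    HomVec deg d (f - g) :=
  fun j => (hf j).sub (hg j)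

lemma vecComp_add (f g : Fin r → Poly K n m) :
    vecComp deg d (f + g) = vecComp deg d f + vecComp deg d g :=
  funext fun _ => map_add _ _ _

lemma HomVec.smul {z : Poly K n m} (hz : IsBihom z e) {f : Fin r → Poly K n m}
    (hf : HomVec deg d f) : HomVec deg (d + e) (z • f) := by
  intro j
  have h := hz.mul (hf j)
  rw [show d + e - deg j = e + (d - deg j) by abel]
  exact h

lemma vecComp_smul {z : Poly K n m} (hz : IsBihom z e) (f : Fin r → Poly K n m) :
    vecComp deg d (z • f) = z • vecComp deg (d - e) f := by
  funext j
  change bicomp _ (z * f j) = z * bicomp _ (f j)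
  rw [bicomp_mul hz, show d - deg j - e = d - e - deg j by abel]

lemma vecComp_mulVec {e : Fin s → ℤ × ℤ} (A : Matrix (Fin r) (Fin s) (Poly K n m))
    (hA : ∀ j k, IsBihom (A j k) (e k - deg j)) (f : Fin s → Poly K n m) :
    vecComp deg d (A.mulVec f) = A.mulVec (vecComp e d f) := by
  funext j
  simp only [vecComp, Matrix.mulVec, dotProduct, map_sum]
  refine Finset.sum_congr rfl fun k _ => ?_
  rw [bicomp_mul (hA j k), show d - deg j - (e k - deg j) = d - e k by abel]

/-- The submodule `Q F` of a free module `F`. -/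
noncomputable def vecIdeal (Q : Ideal (Poly K n m)) (r : ℕ) : Submodule (Poly K n m) (Fin r → Poly K n m) :=
  Submodule.pi Set.univ fun _ => Q

lemma mem_vecIdeal {Q : Ideal (Poly K n m)} {f : Fin r → Poly K n m} :
    f ∈ vecIdeal Q r ↔ ∀ j, f j ∈ Q := by
  simp [vecIdeal, Submodule.mem_pi]

lemma vecIdeal_mono {Q Q' : Ideal (Poly K n m)} (h : Q ≤ Q') : vecIdeal Q r ≤ vecIdeal Q' r :=
  fun _ hf => mem_vecIdeal.2 fun j => h (mem_vecIdeal.1 hf j)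

lemma vecComp_mem_vecIdeal {Q : Ideal (Poly K n m)} (hQ : IsBigraded Q) {f : Fin r → Poly K n m}
    (hf : f ∈ vecIdeal Q r) : vecComp deg d f ∈ vecIdeal Q r :=
  mem_vecIdeal.2 fun j => hQ _ (mem_vecIdeal.1 hf j) _

lemma mulVec_mem_vecIdeal {Q : Ideal (Poly K n m)} (A : Matrix (Fin r) (Fin s) (Poly K n m))
    {f : Fin s → Poly K n m} (hf : f ∈ vecIdeal Q s) : A.mulVec f ∈ vecIdeal Q r :=
  mem_vecIdeal.2 fun j => by
    rw [Matrix.mulVec, dotProduct]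
    exact Q.sum_mem fun k _ => Q.mul_mem_left _ (mem_vecIdeal.1 hf k)

lemma mem_vecIdeal_sup_span {Q : Ideal (Poly K n m)} {z : Poly K n m} {f : Fin r → Poly K n m} :
    f ∈ vecIdeal (Q ⊔ Ideal.span {z}) r ↔ ∃ q ∈ vecIdeal Q r, ∃ h, f = q + z • h := by
  constructor
  · intro hf
    have h : ∀ j, ∃ q ∈ Q, ∃ h, f j = q + z * h := fun j => by
      obtain ⟨q, hq, b, hb, h⟩ := Submodule.mem_sup.1 (mem_vecIdeal.1 hf j)
      obtain ⟨c, rfl⟩ := Ideal.mem_span_singleton'.1 hb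
      exact ⟨q, hq, c, by rw [← h, mul_comm]⟩
    choose q hq h hh using h
    exact ⟨q, mem_vecIdeal.2 hq, h, funext hh⟩
  · rintro ⟨q, hq, h, rfl⟩
    exact mem_vecIdeal.2 fun j => Submodule.add_mem_sup (mem_vecIdeal.1 hq j)
      (Ideal.mul_mem_right _ _ (Ideal.mem_span_singleton_self z))

end HomVec

/-! ### The homology of `F/QF` -/

namespace FreeResolution

variable {J : Ideal (Poly K n m)} (F : FreeResolution J)

/-- The elements of `F_i` which are cycles modulo `Q`. -/
noncomputable def cyc (Q : Ideal (Poly K n m)) :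
    (i : ℕ) → Submodule (Poly K n m) (Fin (F.rk i) → Poly K n m)
  | 0 => ⊤
  | i + 1 => (vecIdeal Q (F.rk i)).comap (F.mat i).mulVecLin

/-- The elements of `F_i` which are boundaries modulo `Q`. -/
noncomputable def bd (Q : Ideal (Poly K n m)) (i : ℕ) :
    Submodule (Poly K n m) (Fin (F.rk i) → Poly K n m) :=
  LinearMap.range (F.mat i).mulVecLin ⊔ vecIdeal Q (F.rk i)

/-- `H_i(F/QF)_d = 0`. -/
def HomologyVanishes (Q : Ideal (Poly K n m)) (i : ℕ) (d : ℤ × ℤ) : Prop :=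
  ∀ f, HomVec (F.deg i) d f → f ∈ F.cyc Q i → f ∈ F.bd Q i

/-- Multiplication by `z` is injective on the bidegree `d` component of the cokernel of
`F_{i+1}/QF_{i+1} → F_i/QF_i`. -/
def MulInjective (z : Poly K n m) (Q : Ideal (Poly K n m)) (i : ℕ) (d : ℤ × ℤ) : Prop :=
  ∀ f, HomVec (F.deg i) d f → z • f ∈ F.bd Q i → f ∈ F.bd Q i

lemma mem_cyc_succ {Q : Ideal (Poly K n m)} {i : ℕ} {f} :
    f ∈ F.cyc Q (i + 1) ↔ (F.mat i).mulVec f ∈ vecIdeal Q (F.rk i) := Iff.rfl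

lemma mem_bd {Q : Ideal (Poly K n m)} {i : ℕ} {f} :
    f ∈ F.bd Q i ↔ ∃ g, ∃ q ∈ vecIdeal Q (F.rk i), f = (F.mat i).mulVec g + q := by
  constructor
  · intro h
    obtain ⟨_, ⟨g, rfl⟩, q, hq, rfl⟩ := Submodule.mem_sup.1 h
    exact ⟨g, q, hq, rfl⟩
  · rintro ⟨g, q, hq, rfl⟩
    exact Submodule.add_mem_sup ⟨g, rfl⟩ hq

lemma mulVec_mulVec (i : ℕ) (f) : (F.mat i).mulVec ((F.mat (i + 1)).mulVec f) = 0 := by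
  have h : (F.mat (i + 1)).mulVecLin f ∈ LinearMap.ker (F.mat i).mulVecLin := by
    rw [← F.exact_succ i]
    exact ⟨f, rfl⟩
  exact h

lemma vecIdeal_le_bd (Q : Ideal (Poly K n m)) (i : ℕ) : vecIdeal Q (F.rk i) ≤ F.bd Q i :=
  le_sup_right

lemma bd_mono {Q Q' : Ideal (Poly K n m)} (h : Q ≤ Q') (i : ℕ) : F.bd Q i ≤ F.bd Q' i :=
  sup_le_sup_left (vecIdeal_mono h) _

lemma cyc_mono {Q Q' : Ideal (Poly K n m)} (h : Q ≤ Q') : ∀ i, F.cyc Q i ≤ F.cyc Q' i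
  | 0 => le_rfl
  | _ + 1 => Submodule.comap_mono (vecIdeal_mono h)

lemma bd_le_cyc (Q : Ideal (Poly K n m)) : ∀ i, F.bd Q i ≤ F.cyc Q i
  | 0 => le_top
  | i + 1 => by
    intro f hf
    obtain ⟨g, q, hq, rfl⟩ := F.mem_bd.1 hf
    rw [mem_cyc_succ, Matrix.mulVec_add, mulVec_mulVec, zero_add]
    exact mulVec_mem_vecIdeal _ hq

/-! ### Adjoining one homogeneous element `z` to `Q`: pieces of the long exact homology sequence. -/

variable {F}
variable {z : Poly K n m} {e : ℤ × ℤ} {Q : Ideal (Poly K n m)}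

/-- The differentials are `S`-linear, so `z` cancels coordinatewise modulo `Q`. Consequently the
kernel of `z` on the cokernel already lies in the homology, which is why `MulInjective` need not
mention cycles. -/
lemma mem_cyc_of_smul (hreg : ∀ p, z * p ∈ Q → p ∈ Q) :
    ∀ {i : ℕ} {f}, z • f ∈ F.cyc Q i → f ∈ F.cyc Q i
  | 0, _, _ => Submodule.mem_top
  | i + 1, f, h => by
    rw [mem_cyc_succ, Matrix.mulVec_smul, mem_vecIdeal] at h
    exact mem_vecIdeal.2 fun j => hreg _ (h j)

lemma HomologyVanishes.mulInjective (hreg : ∀ p, z * p ∈ Q → p ∈ Q) {i : ℕ} {d : ℤ × ℤ}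
    (h : F.HomologyVanishes Q i d) : F.MulInjective z Q i d :=
  fun f hf hz => h f hf (mem_cyc_of_smul hreg (F.bd_le_cyc Q i hz))

lemma HomologyVanishes.of_mulInjective (hz : IsBihom z e) {i : ℕ} {d : ℤ × ℤ}
    (h : F.HomologyVanishes Q i (d + e)) (hi : F.MulInjective z Q i d) :
    F.HomologyVanishes Q i d :=
  fun f hf hc => hi f hf (h _ (hf.smul hz) (Submodule.smul_mem _ _ hc))

lemma HomologyVanishes.sup_zero {d : ℤ × ℤ} {Q' : Ideal (Poly K n m)} (hQ : Q ≤ Q')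
    (h : F.HomologyVanishes Q 0 d) : F.HomologyVanishes Q' 0 d :=
  fun f hf _ => F.bd_mono hQ 0 (h f hf Submodule.mem_top)

/-- This is exactness of `H_{i+1}(F/QF) → H_{i+1}(F/(Q+z)F) → H_i(F/QF)(-e) → H_i(F/QF)` at the
second term. A cycle `f` modulo `Q + (z)` has image `z h` modulo `Q`; injectivity makes `h` the
image of some `g` modulo `Q`, and `f - z g` is then a cycle modulo `Q`. -/
lemma HomologyVanishes.sup_succ (hQ : IsBigraded Q) (hz : IsBihom z e) {i : ℕ} {d : ℤ × ℤ}
    (h : F.HomologyVanishes Q (i + 1) d) (hi : F.MulInjective z Q i (d - e)) :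
    F.HomologyVanishes (Q ⊔ Ideal.span {z}) (i + 1) d := by
  intro f hf hc
  obtain ⟨q, hq, h₀, hfq⟩ := mem_vecIdeal_sup_span.1 (F.mem_cyc_succ.1 hc)
  have e1 := congrArg (vecComp (F.deg i) d) hfq
  rw [vecComp_mulVec _ (F.mat_bihom i), hf.vecComp_eq, vecComp_add, vecComp_smul hz] at e1
  have hzh : z • vecComp (F.deg i) (d - e) h₀ ∈ F.bd Q i :=
    F.mem_bd.2 ⟨f, -vecComp (F.deg i) d q,
      Submodule.neg_mem _ (vecComp_mem_vecIdeal hQ hq), by rw [e1]; abel⟩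
  obtain ⟨g, q', hq', hg⟩ := F.mem_bd.1 (hi _ (homVec_vecComp _ _ _) hzh)
  have e2 := congrArg (vecComp (F.deg i) (d - e)) hg
  rw [(homVec_vecComp _ _ _).vecComp_eq, vecComp_add, vecComp_mulVec _ (F.mat_bihom i)] at e2
  set g' := vecComp (F.deg (i + 1)) (d - e) g with hg'
  have hgz : HomVec (F.deg (i + 1)) d (z • g') := by
    have := (homVec_vecComp (F.deg (i + 1)) (d - e) g).smul hz
    rwa [sub_add_cancel] at this
  have hc' : f - z • g' ∈ F.cyc Q (i + 1) := by
    rw [mem_cyc_succ, Matrix.mulVec_sub, Matrix.mulVec_smul, e1, e2, smul_add,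
      show ∀ a b c : Fin (F.rk i) → Poly K n m, a + (b + c) - b = a + c from fun a b c => by abel]
    exact Submodule.add_mem _ (vecComp_mem_vecIdeal hQ hq)
      (Submodule.smul_mem _ _ (vecComp_mem_vecIdeal hQ hq'))
  have := F.bd_mono (le_sup_left : Q ≤ Q ⊔ Ideal.span {z}) (i + 1) (h _ (hf.sub hgz) hc')
  have h2 : z • g' ∈ F.bd (Q ⊔ Ideal.span {z}) (i + 1) :=
    F.vecIdeal_le_bd _ _ (mem_vecIdeal_sup_span.2 ⟨0, Submodule.zero_mem _, g', by simp⟩)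
  simpa using Submodule.add_mem _ this h2

/-- The connecting map `H_{i+1}(F/(Q+z)F)_{d+e} → H_i(F/QF)_d` has the kernel of `z` as its image.
If `z f` is the image of `g` modulo `Q`, then `g` is a cycle modulo `Q + (z)`, hence a boundary, and
regularity of `z` modulo `Q` allows cancelling `z`. -/
lemma MulInjective.of_homologyVanishes_sup (hreg : ∀ p, z * p ∈ Q → p ∈ Q) (hQ : IsBigraded Q)
    (hz : IsBihom z e) {i : ℕ} {d : ℤ × ℤ}
    (h : F.HomologyVanishes (Q ⊔ Ideal.span {z}) (i + 1) (d + e)) : F.MulInjective z Q i d := by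
  intro f hf hzf
  obtain ⟨g, q, hq, hg⟩ := F.mem_bd.1 hzf
  have e1 := congrArg (vecComp (F.deg i) (d + e)) hg
  rw [(hf.smul hz).vecComp_eq, vecComp_add, vecComp_mulVec _ (F.mat_bihom i)] at e1
  have hq' := vecComp_mem_vecIdeal (deg := F.deg i) (d := d + e) hQ hq
  have hc : vecComp (F.deg (i + 1)) (d + e) g ∈ F.cyc (Q ⊔ Ideal.span {z}) (i + 1) :=
    mem_vecIdeal_sup_span.2 ⟨_, Submodule.neg_mem _ hq', f, by
      rw [Matrix.mulVecLin_apply, e1]; abel⟩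
  obtain ⟨g1, q1, hq1, hg1⟩ := F.mem_bd.1 (h _ (homVec_vecComp _ _ _) hc)
  obtain ⟨q2, hq2, g2, rfl⟩ := mem_vecIdeal_sup_span.1 hq1
  rw [hg1, Matrix.mulVec_add, Matrix.mulVec_add, mulVec_mulVec, zero_add, Matrix.mulVec_smul] at e1
  have h3 : z • (f - (F.mat i).mulVec g2) ∈ vecIdeal Q (F.rk i) := by
    rw [smul_sub, e1, show ∀ a b c : Fin (F.rk i) → Poly K n m, a + b + c - b = a + c
      from fun a b c => by abel]
    exact Submodule.add_mem _ (mulVec_mem_vecIdeal _ hq2) hq'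
  have h4 : f - (F.mat i).mulVec g2 ∈ vecIdeal Q (F.rk i) :=
    mem_vecIdeal.2 fun j => hreg _ (mem_vecIdeal.1 h3 j)
  exact F.mem_bd.2 ⟨g2, _, h4, by abel⟩

/-- The sequence `H_i(F/QF)_{d-e} → H_i(F/QF)_d → H_i(F/(Q+z)F)_d` is exact in the middle. -/
lemma HomologyVanishes.of_sup (hreg : ∀ p, z * p ∈ Q → p ∈ Q) (hQ : IsBigraded Q)
    (hz : IsBihom z e) {i : ℕ} {d : ℤ × ℤ}
    (h : F.HomologyVanishes (Q ⊔ Ideal.span {z}) i d) (h' : F.HomologyVanishes Q i (d - e)) :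
    F.HomologyVanishes Q i d := by
  intro f hf hc
  obtain ⟨g, q, hq, hg⟩ := F.mem_bd.1 (h f hf (F.cyc_mono le_sup_left i hc))
  obtain ⟨q2, hq2, g2, rfl⟩ := mem_vecIdeal_sup_span.1 hq
  have e1 := congrArg (vecComp (F.deg i) d) hg
  rw [hf.vecComp_eq, vecComp_add, vecComp_add, vecComp_smul hz,
    vecComp_mulVec _ (F.mat_bihom i)] at e1
  have hb : f - z • vecComp (F.deg i) (d - e) g2 ∈ F.bd Q i :=
    F.mem_bd.2 ⟨_, _, vecComp_mem_vecIdeal (deg := F.deg i) (d := d) hQ hq2,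
      by rw [e1]; abel⟩
  have hz2 : z • vecComp (F.deg i) (d - e) g2 ∈ F.cyc Q i := by
    have := Submodule.sub_mem _ hc (F.bd_le_cyc Q i hb)
    simpa using this
  have := h' _ (homVec_vecComp _ _ _) (mem_cyc_of_smul hreg hz2)
  simpa using Submodule.add_mem _ hb (Submodule.smul_mem _ z this)

end FreeResolution

/-! ### The ends of the chain `0 = Q_0 ⊆ ⋯ ⊆ Q_{n+m}` -/

lemma IsBihom.constantCoeff_eq_zero {p : Poly K n m} {d : ℤ × ℤ} (hp : IsBihom p d) (hd : d ≠ 0) :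
    MvPolynomial.constantCoeff p = 0 := by
  by_contra h
  exact hd (by simpa using (hp h).symm)

lemma isBihom_C (c : K) : IsBihom (MvPolynomial.C c : Poly K n m) 0 :=
  MvPolynomial.isWeightedHomogeneous_C _ _

namespace FreeResolution

variable {J : Ideal (Poly K n m)} {F : FreeResolution J}

lemma homologyVanishes_bot (i : ℕ) (d : ℤ × ℤ) : F.HomologyVanishes ⊥ (i + 1) d := by
  intro f _ hc
  have h0 : (F.mat i).mulVec f = 0 := by
    funext j
    simpa using mem_vecIdeal.1 (F.mem_cyc_succ.1 hc) j
  have : f ∈ LinearMap.ker (F.mat i).mulVecLin := h0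
  rw [← F.exact_succ i] at this
  exact Submodule.mem_sup_left this

/-- Reduction modulo the variables of an element of bidegree `d`. -/
noncomputable def red {i : ℕ} (d : ℤ × ℤ) (f : Fin (F.rk i) → Poly K n m) : F.fiber i d :=
  fun k => MvPolynomial.constantCoeff (f k.1)

lemma mem_vecIdeal_iff_red {i : ℕ} {d : ℤ × ℤ} {f : Fin (F.rk i) → Poly K n m}
    (hf : HomVec (F.deg i) d f) :
    f ∈ vecIdeal (RingHom.ker MvPolynomial.constantCoeff) (F.rk i) ↔ red d f = 0 := by
  rw [mem_vecIdeal]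
  constructor
  · intro h
    funext k
    exact h k.1
  · intro h j
    by_cases hj : F.deg i j = d
    · exact congrFun h ⟨j, hj⟩
    · exact (hf j).constantCoeff_eq_zero (sub_ne_zero.2 (Ne.symm hj))

lemma homVec_mulVec {i : ℕ} {d : ℤ × ℤ} {g : Fin (F.rk (i + 1)) → Poly K n m}
    (hg : HomVec (F.deg (i + 1)) d g) : HomVec (F.deg i) d ((F.mat i).mulVec g) := by
  rw [← hg.vecComp_eq, ← vecComp_mulVec _ (F.mat_bihom i)]
  exact homVec_vecComp _ _ _

lemma red_mulVec {i : ℕ} {d : ℤ × ℤ} {g : Fin (F.rk (i + 1)) → Poly K n m}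
    (hg : HomVec (F.deg (i + 1)) d g) : red d ((F.mat i).mulVec g) = F.fiberMap i d (red d g) := by
  classical
  funext j
  simp only [red, fiberMap, Matrix.mulVecLin_apply, Matrix.mulVec, dotProduct, map_sum, map_mul,
    Matrix.of_apply]
  refine Eq.trans ?_ (Finset.sum_subtype (Finset.univ.filter fun k => F.deg (i + 1) k = d)
    (p := fun k => F.deg (i + 1) k = d) (by simp)
    fun k => MvPolynomial.constantCoeff (F.mat i j.1 k) * MvPolynomial.constantCoeff (g k))
  rw [Finset.sum_filter]
  refine Finset.sum_congr rfl fun k _ => ?_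
  split_ifs with hk
  · rfl
  · rw [(hg k).constantCoeff_eq_zero (sub_ne_zero.2 (Ne.symm hk)), mul_zero]

open Classical in
/-- The element of bidegree `d` with constant entries which reduces to `v`. -/
noncomputable def constLift {i : ℕ} {d : ℤ × ℤ} (v : F.fiber i d) : Fin (F.rk i) → Poly K n m :=
  fun k => if h : F.deg i k = d then MvPolynomial.C (v ⟨k, h⟩) else 0

lemma homVec_constLift {i : ℕ} {d : ℤ × ℤ} (v : F.fiber i d) :
    HomVec (F.deg i) d (constLift v) := by
  intro k
  unfold constLift
  split_ifs with h
  · rw [h, sub_self]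
    exact isBihom_C _
  · exact MvPolynomial.isWeightedHomogeneous_zero _ _ _

lemma red_constLift {i : ℕ} {d : ℤ × ℤ} (v : F.fiber i d) : red d (constLift v) = v := by
  funext k
  simp [red, constLift, k.2]

lemma mem_cyc_iff_red : ∀ {i : ℕ} {d : ℤ × ℤ} {f : Fin (F.rk i) → Poly K n m},
    HomVec (F.deg i) d f →
    (f ∈ F.cyc (RingHom.ker MvPolynomial.constantCoeff) i ↔ red d f ∈ F.cycles i d)
  | 0, _, _, _ => by simp [cyc, cycles]
  | i + 1, d, f, hf => by
    rw [mem_cyc_succ, mem_vecIdeal_iff_red (homVec_mulVec hf), red_mulVec hf]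
    rfl

lemma red_sub {i : ℕ} {d : ℤ × ℤ} (f g : Fin (F.rk i) → Poly K n m) :
    red d (f - g) = red d f - red d g := by
  funext k
  simp [red]

lemma isBigraded_ker_constantCoeff :
    IsBigraded (RingHom.ker (MvPolynomial.constantCoeff : Poly K n m →+* K)) := by
  intro f hf d
  rw [RingHom.mem_ker] at hf ⊢
  by_cases hd : d = 0
  · classical
    rw [MvPolynomial.constantCoeff_eq] at hf ⊢
    simp [bicomp, MvPolynomial.coeff_weightedHomogeneousComponent, hd, hf]
  · exact (isBihom_bicomp d f).constantCoeff_eq_zero hd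

lemma mem_bd_iff_red {i : ℕ} {d : ℤ × ℤ} {f : Fin (F.rk i) → Poly K n m}
    (hf : HomVec (F.deg i) d f) :
    f ∈ F.bd (RingHom.ker MvPolynomial.constantCoeff) i ↔ red d f ∈ F.boundaries i d := by
  constructor
  · intro h
    obtain ⟨g, q, hq, hg⟩ := F.mem_bd.1 h
    have e1 := congrArg (vecComp (F.deg i) d) hg
    rw [hf.vecComp_eq, vecComp_add, vecComp_mulVec _ (F.mat_bihom i)] at e1
    have e2 := congrArg (red d) (sub_eq_iff_eq_add'.2 e1)
    rw [(mem_vecIdeal_iff_red (homVec_vecComp _ _ _)).1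
      (vecComp_mem_vecIdeal isBigraded_ker_constantCoeff hq), red_sub,
      red_mulVec (homVec_vecComp _ _ _), sub_eq_zero] at e2
    exact ⟨_, e2.symm⟩
  · rintro ⟨w, hw⟩
    have hh : HomVec (F.deg i) d (f - (F.mat i).mulVec (constLift w)) :=
      hf.sub (homVec_mulVec (homVec_constLift w))
    have : f - (F.mat i).mulVec (constLift w) ∈
        vecIdeal (RingHom.ker MvPolynomial.constantCoeff) (F.rk i) := by
      rw [mem_vecIdeal_iff_red hh, red_sub, red_mulVec (homVec_constLift w), red_constLift, hw,
        sub_self]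
    exact F.mem_bd.2 ⟨_, _, this, by abel⟩

/-- Modulo the ideal of the variables an element of bidegree `d` is determined by its constant terms
at the basis elements of bidegree `d`, and every choice of these lifts. So `F/QF` in bidegree `d` is
the complex of fibers computing `Tor`. -/
lemma finrank_tor_eq_zero_iff (i : ℕ) (d : ℤ × ℤ) :
    Module.finrank K (F.Tor i d) = 0 ↔
      F.HomologyVanishes (RingHom.ker MvPolynomial.constantCoeff) i d := by
  rw [Module.finrank_eq_zero_iff_of_free, Submodule.Quotient.subsingleton_iff,
    Submodule.submoduleOf_eq_top]
  constructor
  · intro h f hf hc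
    exact (mem_bd_iff_red hf).2 (h ((mem_cyc_iff_red hf).1 hc))
  · intro h v hv
    have := h _ (homVec_constLift v) ((mem_cyc_iff_red (homVec_constLift v)).2
      (by rwa [red_constLift]))
    rwa [mem_bd_iff_red (homVec_constLift v), red_constLift] at this

/-! ### Homological degree zero: translation into statements about `S/(J + Q)`. -/

section Zero

/-- `L` lifts the augmentation to a map `F_0 → S`. It identifies the cokernel of `F_1/QF_1 →
F_0/QF_0` with `S/(J + Q)`, bidegree by bidegree. -/
lemma exists_augLift (hJ : IsBigraded J) :
    ∃ L : (Fin (F.rk 0) → Poly K n m) →ₗ[Poly K n m] Poly K n m,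
      (∀ f d, HomVec (F.deg 0) d f → IsBihom (L f) d) ∧
      (∀ Q f, f ∈ F.bd Q 0 ↔ L f ∈ J ⊔ Q) ∧
      (∀ p d, IsBihom p d → ∃ f, HomVec (F.deg 0) d f ∧ L f - p ∈ J) := by
  classical
  choose P hP haug using F.aug_bihom
  let L : (Fin (F.rk 0) → Poly K n m) →ₗ[Poly K n m] Poly K n m :=
    ∑ j, (LinearMap.proj j).smulRight (P j)
  have hL : ∀ f, L f = ∑ j, f j * P j := fun f => by simp [L]
  have hmk : ∀ f, F.aug f = Ideal.Quotient.mk J (L f) := by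
    intro f
    have h : F.aug = (Submodule.mkQ J).comp L := by
      refine LinearMap.pi_ext' fun j => LinearMap.ext_ring ?_
      simp only [LinearMap.comp_apply, LinearMap.single_apply, hL]
      rw [haug, Finset.sum_eq_single j]
      · simp
      · intro b _ hb
        simp [Pi.single_eq_of_ne hb]
      · simp
    rw [h]
    rfl
  have hker : ∀ f, L f ∈ J → f ∈ LinearMap.range (F.mat 0).mulVecLin := by
    intro f hf
    rw [F.exact_zero, LinearMap.mem_ker, hmk]
    exact Ideal.Quotient.eq_zero_iff_mem.2 hf
  refine ⟨L, ?_, ?_, ?_⟩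
  · intro f d hf
    rw [hL]
    refine MvPolynomial.IsWeightedHomogeneous.sum _ _ _ fun j _ => ?_
    have := (hf j).mul (hP j)
    rwa [sub_add_cancel] at this
  · intro Q f
    constructor
    · intro h
      obtain ⟨g, q, hq, rfl⟩ := F.mem_bd.1 h
      rw [map_add]
      refine Submodule.add_mem_sup ?_ ?_
      · have : (F.mat 0).mulVecLin g ∈ LinearMap.ker F.aug := F.exact_zero ▸ ⟨g, rfl⟩
        rw [LinearMap.mem_ker, hmk] at this
        exact Ideal.Quotient.eq_zero_iff_mem.1 this
      · rw [hL]
        exact Q.sum_mem fun j _ => Q.mul_mem_right _ (mem_vecIdeal.1 hq j)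
    · intro h
      obtain ⟨a, ha, q, hq, haq⟩ := Submodule.mem_sup.1 h
      -- Since `L w` is 1 modulo `J`, subtracting `q • w`, an element of `Q F_0`, removes the
      -- summand `q` of `L f` modulo `J`.
      obtain ⟨w, hw⟩ := F.aug_surjective (Ideal.Quotient.mk J 1)
      rw [hmk, Ideal.Quotient.eq] at hw
      have : f - q • w ∈ LinearMap.range (F.mat 0).mulVecLin := by
        refine hker _ ?_
        rw [map_sub, map_smul, ← haq, smul_eq_mul,
          show a + q - q * L w = a - q * (L w - 1) by ring]
        exact J.sub_mem ha (J.mul_mem_left _ hw)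
      rw [← sub_add_cancel f (q • w)]
      exact Submodule.add_mem_sup this (mem_vecIdeal.2 fun j => Q.mul_mem_right _ hq)
  · intro p d hp
    obtain ⟨w, hw⟩ := F.aug_surjective (Ideal.Quotient.mk J p)
    rw [hmk, Ideal.Quotient.eq] at hw
    refine ⟨vecComp (F.deg 0) d w, homVec_vecComp _ _ _, ?_⟩
    have h := hJ _ hw d
    rw [map_sub, hp.bicomp_eq, hL, map_sum] at h
    rw [hL]
    convert h using 3 with j
    rw [mul_comm (w j), bicomp_mul (hP j), mul_comm]
    rfl

lemma mulInjective_zero_iff (hJ : IsBigraded J) {z : Poly K n m} {Q : Ideal (Poly K n m)}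
    {d : ℤ × ℤ} :
    F.MulInjective z Q 0 d ↔ ∀ p, IsBihom p d → z * p ∈ J ⊔ Q → p ∈ J ⊔ Q := by
  obtain ⟨L, h1, h2, h3⟩ := exists_augLift (F := F) hJ
  constructor
  · intro h p hp hzp
    obtain ⟨f, hf, hfp⟩ := h3 p d hp
    have hfp' : L f - p ∈ J ⊔ Q := Submodule.mem_sup_left hfp
    have := (h2 Q f).1 (h f hf ((h2 Q _).2 (by
      rw [map_smul, smul_eq_mul, show z * L f = z * (L f - p) + z * p by ring]
      exact Ideal.add_mem _ (Ideal.mul_mem_left _ _ hfp') hzp)))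
    simpa using Ideal.sub_mem _ this hfp'
  · intro h f hf hzf
    rw [h2, map_smul] at hzf
    exact (h2 _ _).2 (h _ (h1 f d hf) hzf)

lemma homologyVanishes_zero_iff (hJ : IsBigraded J) {Q : Ideal (Poly K n m)} {d : ℤ × ℤ} :
    F.HomologyVanishes Q 0 d ↔ ∀ p, IsBihom p d → p ∈ J ⊔ Q := by
  obtain ⟨L, h1, h2, h3⟩ := exists_augLift (F := F) hJ
  constructor
  · intro h p hp
    obtain ⟨f, hf, hfp⟩ := h3 p d hp
    have := (h2 Q f).1 (h f hf Submodule.mem_top)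
    simpa using Ideal.sub_mem _ this (Submodule.mem_sup_left hfp : L f - p ∈ J ⊔ Q)
  · intro h f hf _
    exact (h2 _ _).2 (h _ (h1 f d hf))

end Zero

end FreeResolution

/-! ### The `x`-regularity in terms of an almost regular sequence -/

/-- `z_0, …, z_{n+m-1}` is a regular sequence generating the ideal of the variables, the first `n`
elements have bidegree `(1,0)` and the others bidegree `(0,1)`; `Q_k = (z_0, …, z_{k-1})`. -/
structure IsLinearSystem (z : ℕ → Poly K n m) (Q : ℕ → Ideal (Poly K n m)) : Prop where
  zero : Q 0 = ⊥
  succ : ∀ k < n + m, Q (k + 1) = Q k ⊔ Ideal.span {z k}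
  reg : ∀ k < n + m, ∀ p, z k * p ∈ Q k → p ∈ Q k
  bihom_x : ∀ k < n, IsBihom (z k) (1, 0)
  bihom_y : ∀ k, n ≤ k → k < n + m → IsBihom (z k) (0, 1)
  last : Q (n + m) = RingHom.ker MvPolynomial.constantCoeff

lemma IsLinearSystem.isBigraded {z : ℕ → Poly K n m} {Q : ℕ → Ideal (Poly K n m)}
    (hz : IsLinearSystem z Q) : ∀ k ≤ n + m, IsBigraded (Q k)
  | 0, _ => by
    rw [hz.zero]
    exact isBigraded_bot
  | k + 1, hk => by
    rw [hz.succ k hk]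
    refine (hz.isBigraded k (by omega)).sup ?_
    by_cases h : k < n
    · exact isBigraded_span_singleton (hz.bihom_x k h)
    · exact isBigraded_span_singleton (hz.bihom_y k (by omega) hk)

/-- The `x`-degrees in which `S/(J + Q_n)` or the kernel of `z_k` on `S/(J + Q_k)`, for some
`k < n`, does not vanish. -/
def jumps (z : ℕ → Poly K n m) (Q : ℕ → Ideal (Poly K n m)) (J : Ideal (Poly K n m)) : Set ℤ :=
  {a | ∃ b : ℤ, (∃ p, IsBihom p (a, b) ∧ p ∉ J ⊔ Q n) ∨
    ∃ k < n, ∃ p, IsBihom p (a, b) ∧ z k * p ∈ J ⊔ Q k ∧ p ∉ J ⊔ Q k}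

namespace FreeResolution

variable {J : Ideal (Poly K n m)} (F : FreeResolution J)

/-- The integers `a` such that `Tor_i(S/J, K)_{(a+i,b)} ≠ 0` for some `i` and `b`. -/
def torDegrees : Set ℤ := {a | ∃ (i : ℕ) (b : ℤ), Module.finrank K (F.Tor i (a + i, b)) ≠ 0}

/-- The basis of `F_i` is finite and `S` lives in nonnegative `y`-degrees. This starts the induction
on the `y`-degree below. -/
lemma exists_homVec_eq_zero (i : ℕ) : ∃ c : ℤ, ∀ a b f, b < c →
    HomVec (K := K) (n := n) (m := m) (F.deg i) (a, b) f → f = 0 := by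
  have hc : ∃ c : ℤ, ∀ j, c ≤ (F.deg i j).2 := by
    obtain ⟨c, hc⟩ := (Set.finite_range fun j => (F.deg i j).2).bddBelow
    exact ⟨c, fun j => hc ⟨j, rfl⟩⟩
  obtain ⟨c, hc⟩ := hc
  refine ⟨c, fun a b f hb hf => funext fun j => ?_⟩
  by_contra h
  obtain ⟨e, he⟩ := MvPolynomial.ne_zero_iff.1 h
  have h2 := congrArg Prod.snd (hf j he)
  have : 0 ≤ (Finsupp.weight (wt n m) e).2 := by
    rw [Finsupp.weight_apply, Finsupp.sum, Prod.snd_sum]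
    refine Finset.sum_nonneg fun v _ => ?_
    rcases v with v | v <;> simp [wt]
  have := hc j
  simp only [Prod.snd_sub] at h2
  omega

variable {F} {z : ℕ → Poly K n m} {Q : ℕ → Ideal (Poly K n m)}

/-- A graded Nakayama argument: by `HomologyVanishes.of_sup` the vanishing in `y`-degree `b - 1`
implies that in `b`, and in very low `y`-degrees `F_i` itself is zero. It works because `z_k` does
not change the `x`-degree `a`. -/
lemma homologyVanishes_of_succ_y (hz : IsLinearSystem z Q) {k : ℕ} (hk : n ≤ k) (hk' : k < n + m)
    {i : ℕ} {a : ℤ} (h : ∀ b, F.HomologyVanishes (Q (k + 1)) i (a, b)) (b : ℤ) :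
    F.HomologyVanishes (Q k) i (a, b) := by
  obtain ⟨c, hc⟩ := F.exists_homVec_eq_zero i
  have key : ∀ N : ℕ, F.HomologyVanishes (Q k) i (a, c - 1 + N) := by
    intro N
    induction N with
    | zero =>
      intro f hf _
      rw [hc a _ f (by simp) hf]
      exact Submodule.zero_mem _
    | succ N ih =>
      refine HomologyVanishes.of_sup (hz.reg k hk') (hz.isBigraded k hk'.le)
        (hz.bihom_y k hk hk') ?_ ?_
      · rw [← hz.succ k hk']
        exact h _
      · convert ih using 1
        ext <;> simp
        omega
  by_cases hb : b < c
  · intro f hf _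
    rw [hc a _ f hb hf]
    exact Submodule.zero_mem _
  · have := key (b - (c - 1)).toNat
    rwa [Int.toNat_of_nonneg (by omega), add_sub_cancel] at this

/-- Induction on `k`, starting from exactness of the resolution. In the step `z_k` lowers both the
homological degree and the `x`-degree by one, so `a` is unchanged: for `i > 0` injectivity follows
from the vanishing already known, and for `i = 0` it is the hypothesis. -/
lemma homologyVanishes_x (hz : IsLinearSystem z Q) {r : ℤ}
    (h : ∀ a > r, ∀ b, ∀ k < n, F.MulInjective (z k) (Q k) 0 (a, b)) :
    ∀ k ≤ n, ∀ (i : ℕ), ∀ a > r, ∀ b, F.HomologyVanishes (Q k) (i + 1) (a + (i + 1 : ℕ), b) := by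
  intro k
  induction k with
  | zero =>
    intro _ i a _ b
    rw [hz.zero]
    exact homologyVanishes_bot _ _
  | succ k ih =>
    intro hk i a ha b
    rw [hz.succ k (by omega)]
    refine HomologyVanishes.sup_succ (hz.isBigraded k (by omega)) (hz.bihom_x k hk)
      (ih (by omega) i a ha b) ?_
    have hd : ((a + (i + 1 : ℕ), b) : ℤ × ℤ) - (1, 0) = (a + (i : ℕ), b) := by
      ext <;> simp
      ring
    rw [hd]
    rcases i with _ | i
    · simpa using h a ha b k hk
    · exact (ih (by omega) i a ha b).mulInjective (hz.reg k (by omega))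

/-- Here `z_{n+k}` lowers the homological degree but not the `x`-degree, so the connecting map lands
at `a + 1`, which is still larger than `r`. Hence the `y`-forms need no almost regularity. -/
lemma homologyVanishes_y (hz : IsLinearSystem z Q) {r : ℤ}
    (h : ∀ (i : ℕ), ∀ a > r, ∀ b, F.HomologyVanishes (Q n) i (a + i, b)) :
    ∀ k ≤ m, ∀ (i : ℕ), ∀ a > r, ∀ b, F.HomologyVanishes (Q (n + k)) i (a + i, b) := by
  intro k
  induction k with
  | zero => exact fun _ => h
  | succ k ih =>
    intro hk i a ha b
    rw [← add_assoc, hz.succ (n + k) (by omega)]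
    rcases i with _ | i
    · exact (ih (by omega) 0 a ha b).sup_zero le_sup_left
    · refine HomologyVanishes.sup_succ (hz.isBigraded _ (by omega))
        (hz.bihom_y _ (by omega) (by omega)) (ih (by omega) (i + 1) a ha b) ?_
      have := ih (by omega) i (a + 1) (by omega) (b - 1)
      convert this.mulInjective (hz.reg (n + k) (by omega)) using 1
      ext <;> simp
      ring

lemma mem_upperBounds_torDegrees (hJ : IsBigraded J) (hz : IsLinearSystem z Q) {r : ℤ}
    (h : r ∈ upperBounds (jumps z Q J)) :
    r ∈ upperBounds F.torDegrees := by
  rintro a ⟨i, b, hib⟩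
  by_contra! ha
  refine hib ((finrank_tor_eq_zero_iff _ _).2 ?_)
  rw [← hz.last]
  refine homologyVanishes_y hz ?_ m le_rfl i a ha b
  intro i a ha b
  have hja : a ∉ jumps z Q J := fun hj => absurd (h hj) (by omega)
  rcases i with _ | i
  · rw [homologyVanishes_zero_iff hJ]
    intro p hp
    by_contra hpn
    exact hja ⟨b, Or.inl ⟨p, by simpa using hp, hpn⟩⟩
  · refine homologyVanishes_x hz ?_ n le_rfl i a ha b
    intro a ha b k hk
    have hja : a ∉ jumps z Q J := fun hj => absurd (h hj) (by omega)
    rw [mulInjective_zero_iff hJ]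
    intro p hp hzp
    by_contra hpn
    exact hja ⟨b, Or.inr ⟨k, hk, p, hp, hzp, hpn⟩⟩

/-- If `Tor` vanished along `(r + i, b)`, this vanishing would descend through the `y`-forms and
then the `x`-forms. The latter descent also uses the vanishing above `r`, which holds because `r` is
the largest jump. At the end nothing is left in degree `r` to produce a jump. -/
lemma mem_torDegrees (hJ : IsBigraded J) (hz : IsLinearSystem z Q) {r : ℤ}
    (h : IsGreatest (jumps z Q J) r) : r ∈ F.torDegrees := by
  by_contra hr
  have htop : ∀ (i : ℕ) b, F.HomologyVanishes (Q (n + m)) i (r + i, b) := by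
    intro i b
    rw [hz.last, ← finrank_tor_eq_zero_iff]
    by_contra hne
    exact hr ⟨i, b, hne⟩
  have hn : ∀ j ≤ m, ∀ (i : ℕ) b, F.HomologyVanishes (Q (n + (m - j))) i (r + i, b) := by
    intro j
    induction j with
    | zero => exact fun _ => htop
    | succ j ih =>
      intro hj i b
      refine homologyVanishes_of_succ_y hz (by omega) (by omega) (fun b => ?_) b
      have := ih (by omega) i b
      rwa [show n + (m - j) = n + (m - (j + 1)) + 1 by omega] at this
  have hn' : ∀ (i : ℕ) b, F.HomologyVanishes (Q n) i (r + i, b) := by simpa using hn m le_rfl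
  have hinj : ∀ a > r, ∀ b, ∀ k < n, F.MulInjective (z k) (Q k) 0 (a, b) := by
    intro a ha b k hk
    rw [mulInjective_zero_iff hJ]
    intro p hp hzp
    by_contra hpn
    exact absurd (h.2 ⟨b, Or.inr ⟨k, hk, p, hp, hzp, hpn⟩⟩) (by omega)
  have hup := homologyVanishes_x hz hinj
  have hd : ∀ (i : ℕ) (b : ℤ), ((r + (i + 1 : ℕ), b) : ℤ × ℤ) = (r + i, b) + (1, 0) := by
    intro i b
    ext <;> simp
    ring
  have hx : ∀ j ≤ n, ∀ (i : ℕ) b, F.HomologyVanishes (Q (n - j)) (i + 1) (r + (i + 1 : ℕ), b) := by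
    intro j
    induction j with
    | zero => exact fun _ i b => hn' (i + 1) b
    | succ j ih =>
      intro hj i b
      -- Vanishing one homological degree higher, modulo one more form, makes that form injective on
      -- `H_{i+1}` at `r + i + 1`; its target lies at `(r + 1) + (i + 1)`, where `hup` gives zero.
      have h1 := ih (by omega) (i + 1) b
      rw [show n - j = n - (j + 1) + 1 by omega, hz.succ _ (by omega), hd] at h1
      refine HomologyVanishes.of_mulInjective (hz.bihom_x (n - (j + 1)) (by omega)) ?_
        (MulInjective.of_homologyVanishes_sup (hz.reg _ (by omega)) (hz.isBigraded _ (by omega))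
          (hz.bihom_x (n - (j + 1)) (by omega)) h1)
      have h2 := hup (n - (j + 1)) (by omega) i (r + 1) (by omega) b
      convert h2 using 1
      ext <;> simp
      ring
  obtain ⟨b, ⟨p, hp, hpn⟩ | ⟨k, hk, p, hp, hzp, hpn⟩⟩ := h.1
  · refine hpn ((homologyVanishes_zero_iff (F := F) hJ).1 ?_ p hp)
    simpa using hn' 0 b
  · refine hpn ((mulInjective_zero_iff (F := F) hJ).1 ?_ p hp hzp)
    refine MulInjective.of_homologyVanishes_sup (hz.reg _ (by omega)) (hz.isBigraded _ (by omega))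
      (hz.bihom_x k hk) ?_
    have h1 := hx (n - (k + 1)) (by omega) 0 b
    rw [show n - (n - (k + 1)) = k + 1 by omega, hz.succ _ (by omega), hd] at h1
    simpa using h1

end FreeResolution

/-- For `t` empty every integer bounds `s`, so `s` is empty; otherwise the bounded set `t` has a
greatest element, which is also the greatest element of `s`. -/
lemma sSup_coe_eq {s t : Set ℤ} (ht : BddAbove t) (h₁ : upperBounds t ⊆ upperBounds s)
    (h₂ : ∀ r, IsGreatest t r → r ∈ s) :
    sSup ((fun a : ℤ => ((a : WithTop ℤ) : WithBot (WithTop ℤ))) '' s) =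
      sSup ((fun a : ℤ => ((a : WithTop ℤ) : WithBot (WithTop ℤ))) '' t) := by
  rcases t.eq_empty_or_nonempty with rfl | hne
  · have : s = ∅ := by
      refine Set.eq_empty_of_forall_notMem fun a ha => ?_
      have := h₁ (by simp : a - 1 ∈ upperBounds ∅) ha
      omega
    rw [this]
  · obtain ⟨c, hc⟩ := ht
    obtain ⟨r, hr, hr'⟩ := Int.exists_greatest_of_bdd (P := fun a => a ∈ t) ⟨c, fun a ha => hc ha⟩ hne
    have hg : IsGreatest t r := ⟨hr, fun a ha => hr' a ha⟩
    have hmono : Monotone (fun a : ℤ => ((a : WithTop ℤ) : WithBot (WithTop ℤ))) :=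
      fun a b h => by simpa using h
    have hs : IsGreatest s r := ⟨h₂ r hg, h₁ hg.2⟩
    rw [(hmono.map_isGreatest hs).csSup_eq, (hmono.map_isGreatest hg).csSup_eq]

/-- The `x`-regularity of `S/J` is the supremum of the jumps of an almost regular sequence. -/
theorem regX_eq_sSup_jumps {J : Ideal (Poly K n m)} (hJ : IsBigraded J) {z : ℕ → Poly K n m}
    {Q : ℕ → Ideal (Poly K n m)} (hz : IsLinearSystem z Q) (hb : BddAbove (jumps z Q J)) :
    regX J = sSup ((fun a : ℤ => ((a : WithTop ℤ) : WithBot (WithTop ℤ))) '' jumps z Q J) := by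
  have h := nonempty_freeResolution hJ
  rw [← sSup_coe_eq (s := h.some.torDegrees) hb
    (fun r hr => FreeResolution.mem_upperBounds_torDegrees hJ hz hr)
    (fun r hr => FreeResolution.mem_torDegrees hJ hz hr), regX]
  congr 1
  ext r
  simp only [betti, dif_pos h, Set.mem_ofPred_eq, Set.mem_image, FreeResolution.torDegrees]
  constructor
  · rintro ⟨a, rfl, h⟩
    exact ⟨a, h, rfl⟩
  · rintro ⟨a, h, rfl⟩
    exact ⟨a, rfl, h⟩

/-! ### The reverse lexicographic order -/

lemma weight_eq (e : Fin n ⊕ Fin m →₀ ℕ) :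
    Finsupp.weight (wt n m) e = ((xdeg e : ℤ), (ydeg e : ℤ)) := by
  rw [Finsupp.weight_apply, Finsupp.sum_fintype _ _ (by simp), Fintype.sum_sum_type]
  ext <;> simp [wt, xdeg, ydeg, Prod.fst_sum, Prod.snd_sum]

lemma pos_injective : Function.Injective (pos : Fin n ⊕ Fin m → ℕ) := by
  rintro (i | i) (j | j) h <;> simp only [pos, Sum.elim_inl, Sum.elim_inr] at h
  · exact congrArg _ (Fin.ext (by omega))
  · omega
  · omega
  · exact congrArg _ (Fin.ext (by omega))

lemma RevLexLT.irrefl (e : Fin n ⊕ Fin m →₀ ℕ) : ¬ RevLexLT e e :=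
  fun ⟨_, h, _⟩ => lt_irrefl _ h

lemma RevLexLT.trans {a b c : Fin n ⊕ Fin m →₀ ℕ} (h₁ : RevLexLT a b) (h₂ : RevLexLT b c) :
    RevLexLT a c := by
  obtain ⟨k, hk, hk'⟩ := h₁
  obtain ⟨l, hl, hl'⟩ := h₂
  rcases lt_trichotomy (pos k) (pos l) with h | h | h
  · exact ⟨l, by rwa [← hk' l h], fun i hi => (hl' i hi).trans (hk' i (h.trans hi))⟩
  · obtain rfl := pos_injective h
    exact ⟨k, hl.trans hk, fun i hi => (hl' i hi).trans (hk' i hi)⟩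
  · exact ⟨k, by rwa [hl' k h], fun i hi => (hl' i (h.trans hi)).trans (hk' i hi)⟩

lemma revLexLT_or {a b : Fin n ⊕ Fin m →₀ ℕ} (h : a ≠ b) : RevLexLT a b ∨ RevLexLT b a := by
  classical
  have hne : (Finset.univ.filter fun k => a k ≠ b k).Nonempty := by
    by_contra hemp
    rw [Finset.not_nonempty_iff_eq_empty, Finset.filter_eq_empty_iff] at hemp
    exact h (Finsupp.ext fun k => by simpa using hemp (Finset.mem_univ k))
  obtain ⟨k, hk, hmax⟩ := Finset.exists_max_image _ pos hne
  have hk' : ∀ l, pos k < pos l → a l = b l := fun l hl => by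
    by_contra hl'
    exact absurd (hmax l (by simp [hl'])) (by omega)
  rcases lt_or_gt_of_ne (Finset.mem_filter.1 hk).2 with hlt | hlt
  · exact Or.inr ⟨k, hlt, hk'⟩
  · exact Or.inl ⟨k, hlt, fun l hl => (hk' l hl).symm⟩

instance : IsStrictTotalOrder (Fin n ⊕ Fin m →₀ ℕ) RevLexLT where
  trichotomous a b h₁ h₂ := by
    by_contra h
    exact (revLexLT_or h).elim h₁ h₂
  irrefl := RevLexLT.irrefl
  trans _ _ _ := RevLexLT.trans

lemma RevLexLT.add_right {a b : Fin n ⊕ Fin m →₀ ℕ} (h : RevLexLT a b)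
    (c : Fin n ⊕ Fin m →₀ ℕ) : RevLexLT (a + c) (b + c) := by
  obtain ⟨k, hk, hk'⟩ := h
  exact ⟨k, by simpa using hk, fun l hl => by simpa using hk' l hl⟩

/-- Bigraded ideals can be studied one bidegree at a time, where the degree triples agree; from here
on only the reverse lexicographic comparison matters. -/
lemma termLT_iff {a b : Fin n ⊕ Fin m →₀ ℕ}
    (h : Finsupp.weight (wt n m) a = Finsupp.weight (wt n m) b) :
    TermLT a b ↔ RevLexLT a b := by
  rw [weight_eq, weight_eq, Prod.mk.injEq, Nat.cast_inj, Nat.cast_inj] at h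
  have : degTriple a = degTriple b := by rw [degTriple, degTriple, h.1, h.2]
  simp [TermLT, this]

/-! ### Counting leading exponents -/

/-- Gaussian elimination: the coordinate at the largest element `a` of `M` has rank 1 on `W` if `a`
is a leading position and is zero otherwise, and its kernel is handled by induction. -/
lemma finrank_eq_card_leading {σ V : Type*} [LinearOrder σ] [AddCommGroup V] [Module K V]
    (c : σ → V →ₗ[K] K) (M : Finset σ) :
    ∀ (W : Submodule K V) [FiniteDimensional K W] (_ : ∀ w ∈ W, (∀ e ∈ M, c e w = 0) → w = 0)
      (T : Finset σ) (_ : ∀ e, e ∈ T ↔ e ∈ M ∧ ∃ w ∈ W, c e w ≠ 0 ∧ ∀ e' ∈ M, e < e' → c e' w = 0),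
      Module.finrank K W = T.card := by
  classical
  induction M using Finset.induction_on_max with
  | empty =>
    intro W _ hW T hT
    have h1 : W = ⊥ := (Submodule.eq_bot_iff _).2 fun w hw => hW w hw (by simp)
    have h2 : T = ∅ := Finset.eq_empty_of_forall_notMem fun e he => by simpa using ((hT e).1 he).1
    rw [h1, h2]
    simp
  | insert a M ha ih =>
    intro W _ hW T hT
    have haM : a ∉ M := fun h => lt_irrefl _ (ha a h)
    let φ : W →ₗ[K] K := (c a).comp W.subtype
    let W' : Submodule K V := (LinearMap.ker φ).map W.subtype
    have hmem : ∀ w, w ∈ W' ↔ w ∈ W ∧ c a w = 0 := by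
      intro w
      simp only [W', φ, Submodule.mem_map, LinearMap.mem_ker]
      constructor
      · rintro ⟨y, hy, rfl⟩
        exact ⟨y.2, hy⟩
      · rintro ⟨h1, h2⟩
        exact ⟨⟨w, h1⟩, h2, rfl⟩
    have hr := φ.finrank_range_add_finrank_ker
    have hW' : Module.finrank K W' = Module.finrank K (LinearMap.ker φ) :=
      Submodule.finrank_map_subtype_eq W _
    have hT' : Module.finrank K W' = (T.erase a).card := by
      refine ih W' ?_ (T.erase a) ?_
      · intro w hw h
        rw [hmem] at hw
        exact hW w hw.1 fun e he => (Finset.mem_insert.1 he).elim (fun h => h ▸ hw.2) (h e)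
      · intro e
        rw [Finset.mem_erase, hT, Finset.mem_insert]
        constructor
        · rintro ⟨hea, h1, w, hw, h2, h3⟩
          have he := h1.resolve_left hea
          exact ⟨he, w, (hmem w).2 ⟨hw, h3 a (by simp) (ha e he)⟩, h2,
            fun e' he' => h3 e' (Finset.mem_insert_of_mem he')⟩
        · rintro ⟨he, w, hw, h2, h3⟩
          rw [hmem] at hw
          refine ⟨fun h => haM (h ▸ he), Or.inr he, w, hw.1, h2, fun e' he' hlt => ?_⟩
          rcases Finset.mem_insert.1 he' with rfl | he'
          · exact hw.2
          · exact h3 e' he' hlt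
    by_cases haT : a ∈ T
    · obtain ⟨-, w, hw, h2, -⟩ := (hT a).1 haT
      have hsurj : LinearMap.range φ = ⊤ :=
        LinearMap.range_eq_top.2 (LinearMap.surjective (fun h0 : φ = 0 =>
          h2 (LinearMap.congr_fun h0 ⟨w, hw⟩)))
      rw [hsurj, finrank_top, Module.finrank_self] at hr
      have := Finset.card_erase_add_one haT
      omega
    · have hzero : φ = 0 := by
        ext w
        by_contra hne
        refine haT ((hT a).2 ⟨Finset.mem_insert_self _ _, w.1, w.2, hne, fun e' he' hlt => ?_⟩)
        rcases Finset.mem_insert.1 he' with rfl | he'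
        · exact absurd hlt (lt_irrefl _)
        · exact absurd hlt (ha e' he').asymm
      rw [hzero, LinearMap.range_zero, finrank_bot, ← hzero] at hr
      rw [Finset.erase_eq_of_notMem haT] at hT'
      omega

/-! ### Graded parts of ideals -/

lemma finite_exponents (d : ℤ × ℤ) :
    {e : Fin n ⊕ Fin m →₀ ℕ | Finsupp.weight (wt n m) e = d}.Finite := by
  refine (Finsupp.finite_of_degree_le (d.1 + d.2).toNat).subset fun e he => ?_
  have he' : Finsupp.weight (wt n m) e = d := he
  rw [weight_eq] at he'
  subst he'
  change Finsupp.degree e ≤ _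
  rw [Finsupp.degree_eq_sum, Fintype.sum_sum_type]
  change xdeg e + ydeg e ≤ ((xdeg e : ℤ) + (ydeg e : ℤ)).toNat
  omega

/-- The exponents of bidegree `d`. -/
noncomputable def exponents (n m : ℕ) (d : ℤ × ℤ) : Finset (Fin n ⊕ Fin m →₀ ℕ) :=
  (finite_exponents d).toFinset

lemma mem_exponents {d : ℤ × ℤ} {e : Fin n ⊕ Fin m →₀ ℕ} :
    e ∈ exponents n m d ↔ Finsupp.weight (wt n m) e = d := by
  simp [exponents]

/-- The component of bidegree `d` of an ideal. -/
noncomputable def part (I : Ideal (Poly K n m)) (d : ℤ × ℤ) : Submodule K (Poly K n m) :=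
  I.restrictScalars K ⊓ MvPolynomial.weightedHomogeneousSubmodule K (wt n m) d

lemma mem_part {I : Ideal (Poly K n m)} {d : ℤ × ℤ} {p : Poly K n m} :
    p ∈ part I d ↔ p ∈ I ∧ IsBihom p d := Iff.rfl

lemma part_mono {I I' : Ideal (Poly K n m)} (h : I ≤ I') (d : ℤ × ℤ) : part I d ≤ part I' d :=
  fun _ hp => ⟨h hp.1, hp.2⟩

instance finiteDimensional_part (I : Ideal (Poly K n m)) (d : ℤ × ℤ) :
    FiniteDimensional K (part I d) := by
  let φ : part I d →ₗ[K] (exponents n m d → K) :=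
    (LinearMap.pi fun e => MvPolynomial.lcoeff K e.1).comp (part I d).subtype
  refine FiniteDimensional.of_injective φ ((injective_iff_map_eq_zero φ).2 fun p hp => ?_)
  refine Subtype.ext (MvPolynomial.ext _ _ fun e => ?_)
  by_contra he
  exact he (congrFun hp ⟨e, mem_exponents.2 (p.2.2 he)⟩)

lemma part_sup {I J : Ideal (Poly K n m)} (hI : IsBigraded I) (hJ : IsBigraded J) (d : ℤ × ℤ) :
    part (I ⊔ J) d = part I d ⊔ part J d := by
  apply le_antisymm
  · rintro p ⟨hp, hd⟩
    obtain ⟨a, ha, b, hb, rfl⟩ := Submodule.mem_sup.1 hp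
    have hd' : IsBihom (a + b) d := hd
    rw [← hd'.bicomp_eq, map_add]
    exact Submodule.add_mem_sup ⟨hI a ha d, isBihom_bicomp _ _⟩ ⟨hJ b hb d, isBihom_bicomp _ _⟩
  · exact sup_le (part_mono le_sup_left d) (part_mono le_sup_right d)

lemma part_inf (I J : Ideal (Poly K n m)) (d : ℤ × ℤ) :
    part (I ⊓ J) d = part I d ⊓ part J d := by
  ext p
  simp only [mem_part, Submodule.mem_inf]
  tauto

lemma finrank_part_sup_add {I J : Ideal (Poly K n m)} (hI : IsBigraded I) (hJ : IsBigraded J)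
    (d : ℤ × ℤ) :
    Module.finrank K (part (I ⊔ J) d) + Module.finrank K (part (I ⊓ J) d) =
      Module.finrank K (part I d) + Module.finrank K (part J d) := by
  rw [part_sup hI hJ, part_inf]
  exact Submodule.finrank_sup_add_finrank_inf_eq _ _

lemma IsBigraded.inf {I J : Ideal (Poly K n m)} (hI : IsBigraded I) (hJ : IsBigraded J) :
    IsBigraded (I ⊓ J) :=
  fun f hf d => ⟨hI f hf.1 d, hJ f hf.2 d⟩

/-! ### Leading exponents -/

/-- The exponents of the initial monomials of the elements of `I`. -/
def leadExps (I : Ideal (Poly K n m)) : Set (Fin n ⊕ Fin m →₀ ℕ) :=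
  {e | ∃ f ∈ I, IsInitialExponent f e}

lemma IsBihom.isInitialExponent_iff {f : Poly K n m} {e : Fin n ⊕ Fin m →₀ ℕ}
    (hf : IsBihom f (Finsupp.weight (wt n m) e)) :
    IsInitialExponent f e ↔ e ∈ f.support ∧ ∀ e' ∈ f.support, e' ≠ e → RevLexLT e' e := by
  refine and_congr_right fun he => forall_congr' fun e' => forall_congr' fun he' => ?_
  rw [termLT_iff (hf (MvPolynomial.mem_support_iff.1 he'))]

lemma mem_leadExps_iff {I : Ideal (Poly K n m)} (hI : IsBigraded I)
    {e : Fin n ⊕ Fin m →₀ ℕ} :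
    e ∈ leadExps I ↔ ∃ f ∈ part I (Finsupp.weight (wt n m) e), e ∈ f.support ∧
      ∀ e' ∈ f.support, e' ≠ e → RevLexLT e' e := by
  classical
  constructor
  · rintro ⟨f, hf, he, h⟩
    have hcoe : ∀ e', MvPolynomial.coeff e' (bicomp (Finsupp.weight (wt n m) e) f) =
        if Finsupp.weight (wt n m) e' = Finsupp.weight (wt n m) e then MvPolynomial.coeff e' f
        else 0 := fun e' => by
      simp only [bicomp, MvPolynomial.coeff_weightedHomogeneousComponent]
    refine ⟨bicomp (Finsupp.weight (wt n m) e) f, ⟨hI f hf _, isBihom_bicomp _ _⟩, ?_, ?_⟩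
    · rw [MvPolynomial.mem_support_iff, hcoe, if_pos rfl]
      exact MvPolynomial.mem_support_iff.1 he
    · intro e' he' hne
      rw [MvPolynomial.mem_support_iff, hcoe] at he'
      have hw : Finsupp.weight (wt n m) e' = Finsupp.weight (wt n m) e := by
        by_contra hw
        exact he' (if_neg hw)
      rw [if_pos hw] at he'
      exact (termLT_iff hw).1 (h e' (MvPolynomial.mem_support_iff.2 he') hne)
  · rintro ⟨f, hf, h⟩
    exact ⟨f, hf.1, (IsBihom.isInitialExponent_iff hf.2).2 h⟩

-- Macaulay's principle: elements with distinct leading exponents form a basis of `I_d`. Hence `I`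
-- and `in(I)` have the same Hilbert function.
open Classical in
lemma finrank_part {I : Ideal (Poly K n m)} (hI : IsBigraded I) (d : ℤ × ℤ) :
    Module.finrank K (part I d) = ((exponents n m d).filter (· ∈ leadExps I)).card := by
  refine @finrank_eq_card_leading K _ _ _ (linearOrderOfSTO RevLexLT) _ _
    (fun e => MvPolynomial.lcoeff K e) (exponents n m d) (part I d) _ ?_ _ ?_
  · intro p hp h
    refine MvPolynomial.ext _ _ fun e => ?_
    by_contra he
    exact he (h e (mem_exponents.2 (hp.2 he)))
  · intro e
    rw [Finset.mem_filter, mem_leadExps_iff hI]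
    refine and_congr_right fun he => ?_
    rw [mem_exponents.1 he]
    refine exists_congr fun f => and_congr_right fun hf => and_congr MvPolynomial.mem_support_iff ?_
    constructor
    · intro h e' _ hlt
      by_contra hne
      have hlt : RevLexLT e e' := hlt
      refine RevLexLT.irrefl e (hlt.trans (h e' (MvPolynomial.mem_support_iff.2 hne) ?_))
      rintro rfl
      exact RevLexLT.irrefl _ hlt
    · intro h e' he' hne
      refine (revLexLT_or hne).resolve_right fun hlt => ?_
      exact MvPolynomial.mem_support_iff.1 he' (h e' (mem_exponents.2
        (hf.2 (MvPolynomial.mem_support_iff.1 he'))) hlt)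

lemma leadExps_add {I : Ideal (Poly K n m)} (hI : IsBigraded I) {e : Fin n ⊕ Fin m →₀ ℕ}
    (he : e ∈ leadExps I) (c : Fin n ⊕ Fin m →₀ ℕ) : e + c ∈ leadExps I := by
  classical
  obtain ⟨f, hf, he, h⟩ := (mem_leadExps_iff hI).1 he
  rw [mem_leadExps_iff hI]
  have hsupp : ∀ a, a ∈ (f * MvPolynomial.monomial c (1 : K)).support →
      ∃ b ∈ f.support, a = b + c := by
    intro a ha
    obtain ⟨b, hb, b', hb', rfl⟩ := Finset.mem_add.1 (MvPolynomial.support_mul _ _ ha)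
    rw [MvPolynomial.support_monomial, if_neg one_ne_zero, Finset.mem_singleton] at hb'
    exact ⟨b, hb, by rw [hb']⟩
  refine ⟨f * MvPolynomial.monomial c 1, ⟨I.mul_mem_right _ hf.1, ?_⟩, ?_, ?_⟩
  · rw [map_add]
    exact IsBihom.mul hf.2 (MvPolynomial.isWeightedHomogeneous_monomial _ _ _ rfl)
  · rw [MvPolynomial.mem_support_iff, MvPolynomial.coeff_mul_monomial, mul_one]
    exact MvPolynomial.mem_support_iff.1 he
  · intro a ha hne
    obtain ⟨b, hb, rfl⟩ := hsupp a ha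
    exact (h b hb fun hbe => hne (by rw [hbe])).add_right c

lemma initialIdeal_eq (I : Ideal (Poly K n m)) :
    initialIdeal I = Ideal.span ((fun e => MvPolynomial.monomial e (1 : K)) '' leadExps I) := by
  unfold initialIdeal
  congr 1
  ext q
  constructor
  · rintro ⟨f, hf, e, he, rfl⟩
    exact ⟨e, ⟨f, hf, he⟩, rfl⟩
  · rintro ⟨e, ⟨f, hf, he⟩, rfl⟩
    exact ⟨f, hf, e, he, rfl⟩

lemma mem_initialIdeal_iff {I : Ideal (Poly K n m)} (hI : IsBigraded I) {p : Poly K n m} :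
    p ∈ initialIdeal I ↔ ∀ e ∈ p.support, e ∈ leadExps I := by
  rw [initialIdeal_eq, MvPolynomial.mem_ideal_span_monomial_image]
  refine forall_congr' fun e => forall_congr' fun _ => ?_
  constructor
  · rintro ⟨a, ha, hle⟩
    rw [← add_tsub_cancel_of_le hle]
    exact leadExps_add hI ha _
  · exact fun h => ⟨e, h, le_rfl⟩

lemma support_bicomp_subset (d : ℤ × ℤ) (f : Poly K n m) : (bicomp d f).support ⊆ f.support := by
  classical
  intro e he
  rw [MvPolynomial.mem_support_iff] at he ⊢
  intro h
  refine he ?_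
  simp only [bicomp, MvPolynomial.coeff_weightedHomogeneousComponent, h, ite_self]

lemma isBigraded_initialIdeal {I : Ideal (Poly K n m)} (hI : IsBigraded I) :
    IsBigraded (initialIdeal I) := by
  intro f hf d
  rw [mem_initialIdeal_iff hI] at hf ⊢
  exact fun e he => hf e (support_bicomp_subset d f he)

lemma leadExps_initialIdeal {I : Ideal (Poly K n m)} (hI : IsBigraded I) :
    leadExps (initialIdeal I) = leadExps I := by
  classical
  ext e
  constructor
  · rintro ⟨f, hf, he, -⟩
    exact (mem_initialIdeal_iff hI).1 hf e he
  · intro he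
    refine ⟨MvPolynomial.monomial e 1, (mem_initialIdeal_iff hI).2 ?_, ?_, ?_⟩
    · intro e' he'
      rw [MvPolynomial.support_monomial, if_neg one_ne_zero, Finset.mem_singleton] at he'
      rwa [he']
    · simp
    · intro e' he' hne
      rw [MvPolynomial.support_monomial, if_neg one_ne_zero, Finset.mem_singleton] at he'
      exact absurd he' hne

/-! ### Initial ideals and the ideals of the last variables -/

lemma isBigraded_span_X (s : Set (Fin n ⊕ Fin m)) :
    IsBigraded (Ideal.span (MvPolynomial.X '' s) : Ideal (Poly K n m)) := by
  intro f hf d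
  rw [MvPolynomial.mem_ideal_span_X_image] at hf ⊢
  exact fun e he => hf e (support_bicomp_subset d f he)

/-- The characteristic property of the reverse lexicographic order: if the initial monomial of a
bihomogeneous `f` involves a variable of the final segment `s`, so does every other monomial of `f`.
Indeed a smaller monomial either agrees with it at that variable or has a larger exponent at a
variable at least as late. -/
lemma leadExps_inf_span_X {I : Ideal (Poly K n m)} (hI : IsBigraded I)
    {s : Set (Fin n ⊕ Fin m)} (hs : ∀ v ∈ s, ∀ w, pos v ≤ pos w → w ∈ s) :
    leadExps (I ⊓ Ideal.span (MvPolynomial.X '' s)) = leadExps I ∩ {e | ∃ v ∈ s, e v ≠ 0} := by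
  ext e
  constructor
  · rintro ⟨f, hf, he⟩
    exact ⟨⟨f, hf.1, he⟩, MvPolynomial.mem_ideal_span_X_image.1 hf.2 e he.1⟩
  · rintro ⟨he, v, hv, hev⟩
    obtain ⟨f, hf, he, h⟩ := (mem_leadExps_iff hI).1 he
    refine ⟨f, ⟨hf.1, MvPolynomial.mem_ideal_span_X_image.2 fun e' he' => ?_⟩,
      (IsBihom.isInitialExponent_iff hf.2).2 ⟨he, h⟩⟩
    by_cases hee : e' = e
    · exact ⟨v, hv, hee ▸ hev⟩
    obtain ⟨k, hk, hk'⟩ := h e' he' hee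
    rcases lt_or_ge (pos k) (pos v) with hlt | hle
    · exact ⟨v, hv, hk' v hlt ▸ hev⟩
    · exact ⟨k, hs v hv k hle, by omega⟩

/-- By `leadExps_inf_span_X` the intersections of `I` and of `in(I)` with the ideal of the last
variables have the same leading exponents, hence the same Hilbert function; the dimension formula
for sum and intersection transfers this to the sums. -/
lemma finrank_part_initialIdeal_sup {I : Ideal (Poly K n m)} (hI : IsBigraded I)
    {s : Set (Fin n ⊕ Fin m)} (hs : ∀ v ∈ s, ∀ w, pos v ≤ pos w → w ∈ s) (d : ℤ × ℤ) :
    Module.finrank K (part (initialIdeal I ⊔ Ideal.span (MvPolynomial.X '' s)) d) =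
      Module.finrank K (part (I ⊔ Ideal.span (MvPolynomial.X '' s)) d) := by
  have hB := isBigraded_initialIdeal hI
  have hs' := isBigraded_span_X (K := K) s
  have h1 := finrank_part_sup_add hI hs' d
  have h2 := finrank_part_sup_add hB hs' d
  have h3 : Module.finrank K (part (initialIdeal I ⊓ Ideal.span (MvPolynomial.X '' s)) d) =
      Module.finrank K (part (I ⊓ Ideal.span (MvPolynomial.X '' s)) d) := by
    rw [finrank_part (hB.inf hs'), finrank_part (hI.inf hs'), leadExps_inf_span_X hB hs,
      leadExps_inf_span_X hI hs, leadExps_initialIdeal hI]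
  have h4 : Module.finrank K (part (initialIdeal I) d) = Module.finrank K (part I d) := by
    rw [finrank_part hB, finrank_part hI, leadExps_initialIdeal hI]
  omega

/-! ### The sequence `x_n, …, x_1, y_1, …, y_m` -/

/-- The position of a variable in the sequence `x_n, …, x_1, y_1, …, y_m` (from `0`). -/
def varIdx : Fin n ⊕ Fin m → ℕ := Sum.elim (fun i => n - 1 - i) (fun j => n + j)

open Classical in
/-- The sequence `x_n, …, x_1, y_1, …, y_m`, followed by zeros. -/
noncomputable def varSeq (K : Type u) [Field K] (n m : ℕ) (k : ℕ) : Poly K n m :=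
  if h : ∃ v : Fin n ⊕ Fin m, varIdx v = k then MvPolynomial.X h.choose else 0

/-- The ideal generated by the first `k` elements of `x_n, …, x_1, y_1, …, y_m`. -/
noncomputable def varIdeal (K : Type u) [Field K] (n m : ℕ) (k : ℕ) : Ideal (Poly K n m) :=
  Ideal.span (MvPolynomial.X '' {v | varIdx v < k})

lemma varIdx_injective : Function.Injective (varIdx : Fin n ⊕ Fin m → ℕ) := by
  rintro (i | i) (j | j) h <;> simp only [varIdx, Sum.elim_inl, Sum.elim_inr] at h
  · exact congrArg _ (Fin.ext (by omega))
  · omega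
  · omega
  · exact congrArg _ (Fin.ext (by omega))

lemma varSeq_varIdx (v : Fin n ⊕ Fin m) : varSeq K n m (varIdx v) = MvPolynomial.X v := by
  have h : ∃ w : Fin n ⊕ Fin m, varIdx w = varIdx v := ⟨v, rfl⟩
  rw [varSeq, dif_pos h, varIdx_injective h.choose_spec]

lemma varIdx_rev {k : ℕ} (hk : k < n) :
    varIdx (Sum.inl (Fin.rev ⟨k, hk⟩) : Fin n ⊕ Fin m) = k := by
  simp only [varIdx, Sum.elim_inl, Fin.val_rev]
  omega

lemma varIdx_inr {k : ℕ} (hk : n ≤ k) (hk' : k < n + m) :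
    varIdx (Sum.inr ⟨k - n, by omega⟩ : Fin n ⊕ Fin m) = k := by
  simp only [varIdx, Sum.elim_inr]
  omega

lemma varIdx_lt (v : Fin n ⊕ Fin m) : varIdx v < n + m := by
  rcases v with i | j <;> simp only [varIdx, Sum.elim_inl, Sum.elim_inr] <;> omega

lemma exists_varIdx_eq {k : ℕ} (hk : k < n + m) : ∃ v : Fin n ⊕ Fin m, varIdx v = k := by
  by_cases h : k < n
  · exact ⟨_, varIdx_rev h⟩
  · exact ⟨_, varIdx_inr (by omega) hk⟩

lemma isBihom_X (v : Fin n ⊕ Fin m) : IsBihom (MvPolynomial.X v : Poly K n m) (wt n m v) :=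
  MvPolynomial.isWeightedHomogeneous_X _ _ _

lemma isLinearSystem_varSeq : IsLinearSystem (varSeq K n m) (varIdeal K n m) where
  zero := by simp [varIdeal]
  succ k hk := by
    obtain ⟨v, rfl⟩ := exists_varIdx_eq hk
    rw [varSeq_varIdx, varIdeal, varIdeal, ← Set.image_singleton, ← Ideal.span_union,
      ← Set.image_union]
    congr 2
    ext w
    simp only [Set.mem_ofPred_eq, Set.mem_union, Set.mem_singleton_iff, Nat.lt_succ_iff_lt_or_eq,
      varIdx_injective.eq_iff]
  reg k hk p hp := by
    classical
    obtain ⟨v, rfl⟩ := exists_varIdx_eq hk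
    rw [varSeq_varIdx, varIdeal, mul_comm, MvPolynomial.mem_ideal_span_X_image] at hp
    rw [varIdeal, MvPolynomial.mem_ideal_span_X_image]
    intro e he
    obtain ⟨w, hw, hne⟩ := hp (e + Finsupp.single v 1) (by
      rw [MvPolynomial.support_mul_X]
      exact Finset.mem_map.2 ⟨e, he, rfl⟩)
    refine ⟨w, hw, ?_⟩
    have hwv : v ≠ w := by
      rintro rfl
      exact lt_irrefl _ (show varIdx v < varIdx v from hw)
    simpa [Finsupp.single_apply, hwv] using hne
  bihom_x k hk := by
    rw [← varIdx_rev (m := m) hk, varSeq_varIdx]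
    exact isBihom_X _
  bihom_y k hk hk' := by
    rw [← varIdx_inr hk hk', varSeq_varIdx]
    exact isBihom_X _
  last := by
    ext p
    rw [varIdeal, MvPolynomial.mem_ideal_span_X_image, RingHom.mem_ker,
      MvPolynomial.constantCoeff_eq]
    constructor
    · intro h
      by_contra h0
      obtain ⟨v, -, hv⟩ := h 0 (MvPolynomial.mem_support_iff.2 h0)
      exact hv rfl
    · intro h e he
      have : e ≠ 0 := by
        rintro rfl
        exact MvPolynomial.mem_support_iff.1 he h
      obtain ⟨v, hv⟩ := Finsupp.ne_iff.1 this
      exact ⟨v, varIdx_lt v, hv⟩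

/-! ### Passing to the initial ideal does not change the jumps -/

lemma exists_notMem_iff_finrank {T : Ideal (Poly K n m)} {d : ℤ × ℤ} :
    (∃ p, IsBihom p d ∧ p ∉ T) ↔
      Module.finrank K (part T d) ≠ Module.finrank K (part (⊤ : Ideal (Poly K n m)) d) := by
  rw [← not_iff_not, not_not]
  push Not
  constructor
  · intro h
    rw [le_antisymm (part_mono le_top d) fun p hp => ⟨h p hp.2, hp.2⟩]
  · intro h p hp
    have := Submodule.eq_of_le_of_finrank_eq (part_mono (le_top : T ≤ ⊤) d) h
    exact (this ▸ (⟨Submodule.mem_top, hp⟩ : p ∈ part ⊤ d) : p ∈ part T d).1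

/-- Multiplication by `z` maps `(T : z)_d` isomorphically onto `(T ∩ (z))_{d+e}`, whose dimension
follows from that of the sum. The kernel of `z` on `(S/T)_d` is `(T : z)_d / T_d`, so its vanishing
is a matter of Hilbert functions. -/
lemma exists_mul_mem_iff_finrank {T : Ideal (Poly K n m)} (hT : IsBigraded T) {z : Poly K n m}
    (hz0 : z ≠ 0) {e : ℤ × ℤ} (hz : IsBihom z e) {d : ℤ × ℤ} :
    (∃ p, IsBihom p d ∧ z * p ∈ T ∧ p ∉ T) ↔
      Module.finrank K (part T d) + Module.finrank K (part (T ⊔ Ideal.span {z}) (d + e)) ≠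
        Module.finrank K (part T (d + e)) +
          Module.finrank K (part (Ideal.span {z}) (d + e)) := by
  have hinj : Function.Injective (LinearMap.mulLeft K z) := fun a b h => mul_left_cancel₀ hz0 h
  let C : Submodule K (Poly K n m) :=
    (T.restrictScalars K).comap (LinearMap.mulLeft K z) ⊓
      MvPolynomial.weightedHomogeneousSubmodule K (wt n m) d
  have hC : ∀ p, p ∈ C ↔ z * p ∈ T ∧ IsBihom p d := fun p => Iff.rfl
  have hle : part T d ≤ C := fun p hp => ⟨T.mul_mem_left z hp.1, hp.2⟩
  have hCtop : C ≤ part ⊤ d := fun p hp => ⟨Submodule.mem_top, hp.2⟩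
  have : FiniteDimensional K C := Submodule.finiteDimensional_of_le hCtop
  have hmap : C.map (LinearMap.mulLeft K z) = part (T ⊓ Ideal.span {z}) (d + e) := by
    ext q
    constructor
    · rintro ⟨p, hp, rfl⟩
      refine ⟨⟨hp.1, Ideal.mul_mem_right _ _ (Ideal.mem_span_singleton_self z)⟩, ?_⟩
      rw [add_comm]
      exact hz.mul hp.2
    · rintro ⟨⟨hq, hqz⟩, hd⟩
      obtain ⟨c, rfl⟩ := Ideal.mem_span_singleton'.1 hqz
      have hd' : IsBihom (c * z) (d + e) := hd
      have h1 := hd'.bicomp_eq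
      rw [mul_comm, bicomp_mul hz, add_sub_cancel_right] at h1
      refine ⟨bicomp d c, (hC _).2 ⟨?_, isBihom_bicomp _ _⟩, ?_⟩
      · rw [h1, mul_comm]
        exact hq
      · rw [LinearMap.mulLeft_apply, h1, mul_comm]
  have hfin : Module.finrank K C = Module.finrank K (part (T ⊓ Ideal.span {z}) (d + e)) := by
    rw [← hmap]
    exact (Submodule.equivMapOfInjective _ hinj C).finrank_eq
  have hsum := finrank_part_sup_add hT (isBigraded_span_singleton hz) (d + e)
  rw [← hfin] at hsum
  have key : (∃ p, IsBihom p d ∧ z * p ∈ T ∧ p ∉ T) ↔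
      Module.finrank K (part T d) ≠ Module.finrank K C := by
    rw [← not_iff_not, not_not]
    push Not
    constructor
    · intro h
      rw [le_antisymm hle fun p hp => ⟨h p hp.2 hp.1, hp.2⟩]
    · intro h p hp hzp
      have := Submodule.eq_of_le_of_finrank_eq hle h
      exact (this ▸ (hC p).2 ⟨hzp, hp⟩ : p ∈ part T d).1
  rw [key]
  omega

lemma finrank_part_initialIdeal_sup_varIdeal {I : Ideal (Poly K n m)} (hI : IsBigraded I) {k : ℕ}
    (hk : k ≤ n) (d : ℤ × ℤ) :
    Module.finrank K (part (initialIdeal I ⊔ varIdeal K n m k) d) =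
      Module.finrank K (part (I ⊔ varIdeal K n m k) d) := by
  refine finrank_part_initialIdeal_sup hI ?_ d
  rintro (i | i) hi (j | j) hij <;>
    simp only [varIdx, pos, Sum.elim_inl, Sum.elim_inr, Set.mem_ofPred_eq] at * <;> omega

/-- Both kinds of jumps are detected by the Hilbert functions of `I + Q_k` with `k ≤ n`, and for
these `k` the ideal `Q_k` is generated by the last variables of the order. -/
theorem jumps_initialIdeal {I : Ideal (Poly K n m)} (hI : IsBigraded I) :
    jumps (varSeq K n m) (varIdeal K n m) (initialIdeal I) =
      jumps (varSeq K n m) (varIdeal K n m) I := by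
  have hB := isBigraded_initialIdeal hI
  have hz := isLinearSystem_varSeq (K := K) (n := n) (m := m)
  ext a
  refine exists_congr fun b => or_congr ?_ (exists_congr fun k => and_congr_right fun hk => ?_)
  · rw [exists_notMem_iff_finrank, exists_notMem_iff_finrank,
      finrank_part_initialIdeal_sup_varIdeal hI le_rfl]
  · have h0 : varSeq K n m k ≠ 0 := by
      rw [← varIdx_rev (m := m) hk, varSeq_varIdx]
      exact MvPolynomial.X_ne_zero _
    have hQ := hz.isBigraded k (by omega)
    rw [exists_mul_mem_iff_finrank (hB.sup hQ) h0 (hz.bihom_x k hk),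
      exists_mul_mem_iff_finrank (hI.sup hQ) h0 (hz.bihom_x k hk), sup_assoc, sup_assoc,
      ← hz.succ k (by omega), finrank_part_initialIdeal_sup_varIdeal hI hk.le,
      finrank_part_initialIdeal_sup_varIdeal hI hk.le,
      finrank_part_initialIdeal_sup_varIdeal hI hk]

/-! ### The action of `G` -/

lemma act_X_inl (g : Grp K n m) (j : Fin n) :
    act g (MvPolynomial.X (Sum.inl j)) =
      ∑ i, MvPolynomial.C (g.1.1 i j) * MvPolynomial.X (Sum.inl i) := by
  simp [act]

lemma act_X_inr (g : Grp K n m) (l : Fin m) :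
    act g (MvPolynomial.X (Sum.inr l)) =
      ∑ k, MvPolynomial.C (g.2.1 k l) * MvPolynomial.X (Sum.inr k) := by
  simp [act]

lemma act_act (g h : Grp K n m) (p : Poly K n m) : act g (act h p) = act (g * h) p := by
  have : (act g).comp (act h) = act (g * h) := by
    refine MvPolynomial.algHom_ext fun v => ?_
    rcases v with j | l
    · simp only [AlgHom.comp_apply, act_X_inl, map_sum, map_mul, MvPolynomial.algHom_C,
        MvPolynomial.algebraMap_eq, Finset.mul_sum, Prod.fst_mul, Units.val_mul, Matrix.mul_apply,
        Finset.sum_mul]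
      rw [Finset.sum_comm]
      exact Finset.sum_congr rfl fun i _ => Finset.sum_congr rfl fun k _ => by ring
    · simp only [AlgHom.comp_apply, act_X_inr, map_sum, map_mul, MvPolynomial.algHom_C,
        MvPolynomial.algebraMap_eq, Finset.mul_sum, Prod.snd_mul, Units.val_mul, Matrix.mul_apply,
        Finset.sum_mul]
      rw [Finset.sum_comm]
      exact Finset.sum_congr rfl fun i _ => Finset.sum_congr rfl fun k _ => by ring
  exact DFunLike.congr_fun this p

lemma act_one (p : Poly K n m) : act (1 : Grp K n m) p = p := by
  have : act (1 : Grp K n m) = AlgHom.id K (Poly K n m) := by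
    refine MvPolynomial.algHom_ext fun v => ?_
    rcases v with j | l
    · rw [act_X_inl, Finset.sum_eq_single j] <;> simp +contextual
    · rw [act_X_inr, Finset.sum_eq_single l] <;> simp +contextual
  exact DFunLike.congr_fun this p

lemma act_act_inv (g : Grp K n m) (p : Poly K n m) : act g (act g⁻¹ p) = p := by
  rw [act_act, mul_inv_cancel, act_one]

lemma act_inv_act (g : Grp K n m) (p : Poly K n m) : act g⁻¹ (act g p) = p := by
  rw [act_act, inv_mul_cancel, act_one]

lemma isBihom_act {p : Poly K n m} {d : ℤ × ℤ} (hp : IsBihom p d) (g : Grp K n m) :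
    IsBihom (act g p) d := by
  have hX : ∀ v, IsBihom (act g (MvPolynomial.X v)) (wt n m v) := by
    rintro (j | l)
    · rw [act_X_inl]
      refine MvPolynomial.IsWeightedHomogeneous.sum _ _ _ fun i _ => ?_
      have := (isBihom_C (n := n) (m := m) (g.1.1 i j)).mul (isBihom_X (K := K) (Sum.inl i))
      rwa [zero_add] at this
    · rw [act_X_inr]
      refine MvPolynomial.IsWeightedHomogeneous.sum _ _ _ fun i _ => ?_
      have := (isBihom_C (n := n) (m := m) (g.2.1 i l)).mul (isBihom_X (K := K) (Sum.inr i))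
      rwa [zero_add] at this
  rw [p.as_sum, map_sum]
  refine MvPolynomial.IsWeightedHomogeneous.sum _ _ _ fun e he => ?_
  rw [← hp (MvPolynomial.mem_support_iff.1 he), MvPolynomial.monomial_eq, map_mul,
    MvPolynomial.algHom_C, MvPolynomial.algebraMap_eq, Finsupp.prod, map_prod,
    ← zero_add (Finsupp.weight (wt n m) e), Finsupp.weight_apply, Finsupp.sum]
  refine (isBihom_C _).mul (MvPolynomial.IsWeightedHomogeneous.prod _ _ _ fun v _ => ?_)
  rw [map_pow]
  exact MvPolynomial.IsWeightedHomogeneous.pow (hX v) _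

lemma isBihom_act_iff {p : Poly K n m} {d : ℤ × ℤ} (g : Grp K n m) :
    IsBihom (act g p) d ↔ IsBihom p d :=
  ⟨fun h => by simpa [act_inv_act] using isBihom_act h g⁻¹, fun h => isBihom_act h g⟩

lemma bicomp_act (g : Grp K n m) (d : ℤ × ℤ) (p : Poly K n m) :
    bicomp d (act g p) = act g (bicomp d p) := by
  classical
  induction p using MvPolynomial.induction_on' with
  | monomial e c =>
    have h : IsBihom (MvPolynomial.monomial e c : Poly K n m) (Finsupp.weight (wt n m) e) :=
      MvPolynomial.isWeightedHomogeneous_monomial _ _ _ rfl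
    have h' := isBihom_act h g
    simp only [bicomp]
    rw [MvPolynomial.weightedHomogeneousComponent_of_mem h,
      MvPolynomial.weightedHomogeneousComponent_of_mem h']
    split_ifs <;> simp
  | add p q hp hq => simp only [map_add, hp, hq]

lemma mem_map_act {I : Ideal (Poly K n m)} {g : Grp K n m} {p : Poly K n m} :
    p ∈ I.map (act g) ↔ act g⁻¹ p ∈ I := by
  constructor
  · intro h
    have : I.map (act g) ≤ I.comap (act g⁻¹) :=
      Ideal.map_le_iff_le_comap.2 fun q hq => by
        rw [Ideal.mem_comap, Ideal.mem_comap, act_inv_act]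
        exact hq
    exact this h
  · intro h
    rw [← act_act_inv g p]
    exact Ideal.mem_map_of_mem _ h

lemma isBigraded_map_act {I : Ideal (Poly K n m)} (hI : IsBigraded I) (g : Grp K n m) :
    IsBigraded (I.map (act g)) := by
  intro f hf d
  rw [mem_map_act] at hf ⊢
  rw [← bicomp_act]
  exact hI _ hf d

lemma constantCoeff_act (g : Grp K n m) (p : Poly K n m) :
    MvPolynomial.constantCoeff (act g p) = MvPolynomial.constantCoeff p := by
  have : (MvPolynomial.constantCoeff).comp (act g).toRingHom =
      (MvPolynomial.constantCoeff : Poly K n m →+* K) := by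
    refine MvPolynomial.ringHom_ext (fun c => by simp) fun v => ?_
    rcases v with j | l
    · simp [act_X_inl]
    · simp [act_X_inr]
  exact RingHom.congr_fun this p

/-- The image of a linear system under `g⁻¹`. -/
lemma IsLinearSystem.act_inv {z : ℕ → Poly K n m} {Q : ℕ → Ideal (Poly K n m)}
    (hz : IsLinearSystem z Q) (g : Grp K n m) :
    IsLinearSystem (fun k => act g⁻¹ (z k)) (fun k => (Q k).map (act g⁻¹)) where
  zero := by
    rw [hz.zero]
    exact Ideal.map_bot
  succ k hk := by rw [hz.succ k hk, Ideal.map_sup, Ideal.map_span, Set.image_singleton]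
  reg k hk p hp := by
    rw [mem_map_act, inv_inv] at hp ⊢
    rw [map_mul, act_act_inv] at hp
    exact hz.reg k hk _ hp
  bihom_x k hk := isBihom_act (hz.bihom_x k hk) _
  bihom_y k hk hk' := isBihom_act (hz.bihom_y k hk hk') _
  last := by
    ext p
    rw [mem_map_act, inv_inv, hz.last, RingHom.mem_ker, RingHom.mem_ker, constantCoeff_act]

lemma act_mem_sup_iff {I I' : Ideal (Poly K n m)} (g : Grp K n m) {p : Poly K n m} :
    act g p ∈ I.map (act g) ⊔ I' ↔ p ∈ I ⊔ I'.map (act g⁻¹) := by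
  have h : I' = (I'.map (act g⁻¹)).map (act g) := by
    ext q
    rw [mem_map_act, mem_map_act, inv_inv, act_act_inv]
  rw [h, ← Ideal.map_sup, ← h, mem_map_act, act_inv_act]

/-- The automorphism `g` carries multiplication by `g⁻¹ z_k` on quotients of `S/J` to multiplication
by `z_k` on quotients of `S/gJ` and preserves bidegrees. -/
theorem jumps_act (z : ℕ → Poly K n m) (Q : ℕ → Ideal (Poly K n m)) (J : Ideal (Poly K n m))
    (g : Grp K n m) :
    jumps (fun k => act g⁻¹ (z k)) (fun k => (Q k).map (act g⁻¹)) J =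
      jumps z Q (J.map (act g)) := by
  have hsurj : Function.Surjective (act g) := fun p => ⟨act g⁻¹ p, act_act_inv g p⟩
  ext a
  refine exists_congr fun b => or_congr ?_ (exists_congr fun k => and_congr_right fun hk => ?_)
  · symm
    rw [hsurj.exists]
    simp only [isBihom_act_iff, act_mem_sup_iff]
  · symm
    rw [hsurj.exists]
    refine exists_congr fun p => ?_
    have h : z k * act g p = act g (act g⁻¹ (z k) * p) := by rw [map_mul, act_act_inv]
    simp only [h, isBihom_act_iff, act_mem_sup_iff]

/-! ### Generic properties -/

/-- A property of the elements of `G` which holds where some polynomial, not vanishing identically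
on `G`, does not vanish. -/
def IsGeneric (p : Grp K n m → Prop) : Prop :=
  ∃ P : MvPolynomial ((Fin n × Fin n) ⊕ (Fin m × Fin m)) K,
    (∃ g : Grp K n m, MvPolynomial.eval (entries g) P ≠ 0) ∧
      ∀ g : Grp K n m, MvPolynomial.eval (entries g) P ≠ 0 → p g

/-- The product of the determinants of the two generic matrices. -/
noncomputable def detPoly (K : Type u) [Field K] (n m : ℕ) :
    MvPolynomial ((Fin n × Fin n) ⊕ (Fin m × Fin m)) K :=
  (Matrix.of fun i j => MvPolynomial.X (Sum.inl (i, j))).det *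
    (Matrix.of fun i j => MvPolynomial.X (Sum.inr (i, j))).det

lemma eval_detPoly (a : (Fin n × Fin n) ⊕ (Fin m × Fin m) → K) :
    MvPolynomial.eval a (detPoly K n m) =
      (Matrix.of fun i j => a (Sum.inl (i, j))).det *
        (Matrix.of fun i j => a (Sum.inr (i, j))).det := by
  rw [detPoly, map_mul, RingHom.map_det, RingHom.map_det]
  congr 2 <;> ext i j <;> simp

lemma eval_detPoly_entries (g : Grp K n m) :
    MvPolynomial.eval (entries g) (detPoly K n m) = g.1.1.det * g.2.1.det := by
  rw [eval_detPoly]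
  rfl

lemma eval_detPoly_ne_zero (g : Grp K n m) :
    MvPolynomial.eval (entries g) (detPoly K n m) ≠ 0 := by
  rw [eval_detPoly_entries]
  exact mul_ne_zero g.1.det_ne_zero g.2.det_ne_zero

lemma exists_entries_eq {a : (Fin n × Fin n) ⊕ (Fin m × Fin m) → K}
    (h : MvPolynomial.eval a (detPoly K n m) ≠ 0) : ∃ g : Grp K n m, entries g = a := by
  rw [eval_detPoly] at h
  refine ⟨(Matrix.GeneralLinearGroup.mkOfDetNeZero _ (left_ne_zero_of_mul h),
    Matrix.GeneralLinearGroup.mkOfDetNeZero _ (right_ne_zero_of_mul h)), ?_⟩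
  funext v
  rcases v with v | v <;> rfl

lemma exists_eval_entries_ne_zero [Infinite K]
    {P : MvPolynomial ((Fin n × Fin n) ⊕ (Fin m × Fin m)) K} (hP : P ≠ 0) :
    ∃ g : Grp K n m, MvPolynomial.eval (entries g) P ≠ 0 := by
  have hdet : detPoly K n m ≠ 0 := fun h =>
    eval_detPoly_ne_zero (1 : Grp K n m) (by rw [h, map_zero])
  obtain ⟨a, ha⟩ : ∃ a, MvPolynomial.eval a (P * detPoly K n m) ≠ 0 := by
    by_contra! h
    exact mul_ne_zero hP hdet (MvPolynomial.funext fun a => by rw [h a, map_zero])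
  rw [map_mul] at ha
  obtain ⟨g, rfl⟩ := exists_entries_eq (right_ne_zero_of_mul ha)
  exact ⟨g, left_ne_zero_of_mul ha⟩

lemma IsGeneric.exists {p : Grp K n m → Prop} (hp : IsGeneric p) : ∃ g, p g := by
  obtain ⟨P, ⟨g, hg⟩, h⟩ := hp
  exact ⟨g, h g hg⟩

lemma IsGeneric.mono {p q : Grp K n m → Prop} (hp : IsGeneric p) (h : ∀ g, p g → q g) :
    IsGeneric q := by
  obtain ⟨P, hP, hp⟩ := hp
  exact ⟨P, hP, fun g hg => h g (hp g hg)⟩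

lemma IsGeneric.and [Infinite K] {p q : Grp K n m → Prop} (hp : IsGeneric p) (hq : IsGeneric q) :
    IsGeneric fun g => p g ∧ q g := by
  obtain ⟨P, ⟨g, hg⟩, hp⟩ := hp
  obtain ⟨P', ⟨g', hg'⟩, hq⟩ := hq
  have h1 : P ≠ 0 := by
    rintro rfl
    simp at hg
  have h2 : P' ≠ 0 := by
    rintro rfl
    simp at hg'
  refine ⟨P * P', exists_eval_entries_ne_zero (mul_ne_zero h1 h2), fun g hg => ?_⟩
  rw [map_mul] at hg
  exact ⟨hp g (left_ne_zero_of_mul hg), hq g (right_ne_zero_of_mul hg)⟩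

lemma isGeneric_true : IsGeneric fun _ : Grp K n m => True :=
  ⟨1, ⟨1, by simp⟩, fun _ _ => trivial⟩

lemma IsGeneric.forall_finset [Infinite K] {ι : Type*} {p : ι → Grp K n m → Prop}
    (h : ∀ i, IsGeneric (p i)) (s : Finset ι) : IsGeneric fun g => ∀ i ∈ s, p i g := by
  classical
  induction s using Finset.induction_on with
  | empty => exact isGeneric_true.mono fun g _ => by simp
  | insert i s _ ih => exact ((h i).and ih).mono fun g hg => by simpa using hg

/-- The coefficients of `g f` are polynomials in the entries of `g`. -/
lemma exists_coeff_act_eq (f : Poly K n m) (e : Fin n ⊕ Fin m →₀ ℕ) :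
    ∃ P : MvPolynomial ((Fin n × Fin n) ⊕ (Fin m × Fin m)) K, ∀ g : Grp K n m,
      MvPolynomial.coeff e (act g f) = MvPolynomial.eval (entries g) P := by
  let R := MvPolynomial ((Fin n × Fin n) ⊕ (Fin m × Fin m)) K
  let φ : Poly K n m →ₐ[K] MvPolynomial (Fin n ⊕ Fin m) R :=
    MvPolynomial.aeval (Sum.elim
      (fun j => ∑ i, MvPolynomial.C (MvPolynomial.X (Sum.inl (i, j))) *
        MvPolynomial.X (Sum.inl i))
      (fun l => ∑ k, MvPolynomial.C (MvPolynomial.X (Sum.inr (k, l))) *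
        MvPolynomial.X (Sum.inr k)))
  refine ⟨MvPolynomial.coeff e (φ f), fun g => ?_⟩
  have h : (MvPolynomial.map (MvPolynomial.eval (entries g))).comp φ.toRingHom =
      (act g).toRingHom := by
    refine MvPolynomial.ringHom_ext (fun c => ?_) fun v => ?_
    · simp only [RingHom.comp_apply, AlgHom.toRingHom_eq_coe, RingHom.coe_coe,
        MvPolynomial.algHom_C, MvPolynomial.algebraMap_apply, MvPolynomial.map_C]
      exact congrArg _ (MvPolynomial.eval_C c)
    · rcases v with j | l
      · simp [φ, act_X_inl, entries]
      · simp [φ, act_X_inr, entries]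
  rw [← MvPolynomial.coeff_map]
  exact congrArg _ (RingHom.congr_fun h f).symm

/-- The rank of a linear map which depends polynomially on `g` is generically constant. -/
lemma exists_isGeneric_finrank_range_eq {W T : Type*} [AddCommGroup W] [Module K W] [Fintype T]
    (φ : Grp K n m → W →ₗ[K] (T → K))
    (hφ : ∀ w t, ∃ P : MvPolynomial ((Fin n × Fin n) ⊕ (Fin m × Fin m)) K, ∀ g : Grp K n m,
      φ g w t = MvPolynomial.eval (entries g) P) :
    ∃ ρ : ℕ, IsGeneric fun g => Module.finrank K (LinearMap.range (φ g)) = ρ := by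
  classical
  choose p hp using hφ
  obtain ⟨g₀, hg₀⟩ : ∃ g₀, ∀ g, Module.finrank K (LinearMap.range (φ g)) ≤
      Module.finrank K (LinearMap.range (φ g₀)) := by
    have hb : BddAbove (Set.range fun g => Module.finrank K (LinearMap.range (φ g))) :=
      ⟨Module.finrank K (T → K), by rintro _ ⟨g, rfl⟩; exact Submodule.finrank_le _⟩
    obtain ⟨g₀, h⟩ := Nat.sSup_mem (Set.range_nonempty _) hb
    exact ⟨g₀, fun g => (le_csSup hb ⟨g, rfl⟩).trans_eq h.symm⟩
  set ρ := Module.finrank K (LinearMap.range (φ g₀)) with hρ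
  let b := Module.finBasis K (LinearMap.range (φ g₀))
  choose w hw using fun i => (b i).2
  have hinj : LinearMap.ker ((LinearMap.range (φ g₀)).subtype.comp
      b.equivFun.symm.toLinearMap) = ⊥ := by
    rw [LinearMap.ker_eq_bot]
    exact (Submodule.injective_subtype _).comp b.equivFun.symm.injective
  obtain ⟨ψ, hψ⟩ := LinearMap.exists_leftInverse_of_injective _ hinj
  have hψb : ∀ j, ψ (φ g₀ (w j)) = Pi.single j 1 := by
    intro j
    have := LinearMap.congr_fun hψ (Pi.single j 1)
    simpa [hw] using this
  -- The matrix of `ψ ∘ φ g` on the vectors `w j`. It is the identity at `g₀`, and where its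
  -- determinant is nonzero the rank is at least the maximal value `ρ`.
  let M : Matrix (Fin ρ) (Fin ρ) (MvPolynomial ((Fin n × Fin n) ⊕ (Fin m × Fin m)) K) :=
    Matrix.of fun i j => ∑ t, MvPolynomial.C (ψ (Pi.single t 1) i) * p (w j) t
  have hM : ∀ g, (MvPolynomial.eval (entries g)).mapMatrix M =
      Matrix.of fun i j => ψ (φ g (w j)) i := by
    intro g
    ext i j
    have h1 : φ g (w j) = ∑ t, φ g (w j) t • (Pi.single t 1 : T → K) := by
      funext s
      simp [Finset.sum_apply, Pi.single_apply]
    rw [Matrix.of_apply, h1, map_sum, Finset.sum_apply]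
    simp [M, hp, mul_comm]
  refine ⟨ρ, M.det, ⟨g₀, ?_⟩, fun g hg => le_antisymm (hg₀ g) ?_⟩
  · rw [RingHom.map_det, hM]
    have : (Matrix.of fun i j => ψ (φ g₀ (w j)) i) = (1 : Matrix (Fin ρ) (Fin ρ) K) := by
      ext i j
      rw [Matrix.of_apply, hψb, Matrix.one_apply, Pi.single_apply]
    rw [this, Matrix.det_one]
    exact one_ne_zero
  · rw [RingHom.map_det, hM] at hg
    set N : Matrix (Fin ρ) (Fin ρ) K := Matrix.of fun i j => ψ (φ g (w j)) i with hN
    have hsurj : LinearMap.range (ψ.comp (φ g)) = ⊤ := by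
      refine LinearMap.range_eq_top.2 fun y => ⟨∑ j, (N⁻¹.mulVec y) j • w j, ?_⟩
      have h2 : N.mulVec (N⁻¹.mulVec y) = y := by
        rw [Matrix.mulVec_mulVec, Matrix.mul_nonsing_inv _ (isUnit_iff_ne_zero.2 hg),
          Matrix.one_mulVec]
      rw [map_sum]
      conv_rhs => rw [← h2]
      funext i
      simp only [Finset.sum_apply, map_smul, Pi.smul_apply, smul_eq_mul, LinearMap.comp_apply]
      rw [Matrix.mulVec, dotProduct]
      exact Finset.sum_congr rfl fun j _ => mul_comm _ _
    have h3 : Module.finrank K (LinearMap.range (ψ.comp (φ g))) = ρ := by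
      rw [hsurj, finrank_top, Module.finrank_fin_fun]
    rw [← h3, LinearMap.range_comp]
    exact Submodule.finrank_map_le _ _

/-! ### Existence of the bigeneric initial ideal -/

lemma part_map_act (I : Ideal (Poly K n m)) (g : Grp K n m) (d : ℤ × ℤ) :
    part (I.map (act g)) d = (part I d).map (act g).toLinearMap := by
  ext p
  constructor
  · rintro ⟨hp, hd⟩
    exact ⟨act g⁻¹ p, ⟨mem_map_act.1 hp, isBihom_act hd _⟩, act_act_inv g p⟩
  · rintro ⟨q, hq, rfl⟩
    exact ⟨Ideal.mem_map_of_mem _ hq.1, isBihom_act hq.2 g⟩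

lemma finrank_part_map_act (I : Ideal (Poly K n m)) (g : Grp K n m) (d : ℤ × ℤ) :
    Module.finrank K (part (I.map (act g)) d) = Module.finrank K (part I d) := by
  rw [part_map_act]
  have hinj : Function.Injective (act g).toLinearMap := fun p q h => by
    have := congrArg (act g⁻¹) (show act g p = act g q from h)
    rwa [act_inv_act, act_inv_act] at this
  exact (Submodule.equivMapOfInjective _ hinj _).finrank_eq.symm

/-- The coefficients of `g f` at the exponents in `T`, for `f ∈ J` of bidegree `d`. -/
noncomputable def coeffMap (J : Ideal (Poly K n m)) (d : ℤ × ℤ)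
    (T : Finset (Fin n ⊕ Fin m →₀ ℕ)) (g : Grp K n m) : part J d →ₗ[K] (T → K) :=
  (LinearMap.pi fun t => MvPolynomial.lcoeff K t.1).comp
    ((act g).toLinearMap.comp (part J d).subtype)

lemma mem_ker_coeffMap {J : Ideal (Poly K n m)} {d : ℤ × ℤ} {T : Finset (Fin n ⊕ Fin m →₀ ℕ)}
    {g : Grp K n m} {f : part J d} :
    f ∈ LinearMap.ker (coeffMap J d T g) ↔
      ∀ t ∈ T, MvPolynomial.coeff t (act g (f : Poly K n m)) = 0 := by
  rw [LinearMap.mem_ker]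
  exact ⟨fun h t ht => congrFun h ⟨t, ht⟩, fun h => funext fun t => h t.1 t.2⟩

lemma exists_isGeneric_finrank_coeffMap (J : Ideal (Poly K n m)) (d : ℤ × ℤ)
    (T : Finset (Fin n ⊕ Fin m →₀ ℕ)) :
    ∃ ρ : ℕ, IsGeneric fun g => Module.finrank K (LinearMap.range (coeffMap J d T g)) = ρ :=
  exists_isGeneric_finrank_range_eq _ fun w t => exists_coeff_act_eq w.1 t.1

/-- The exponent `e` leads an element of `gJ` exactly when some `f ∈ J_d` has `g f` vanishing at all
exponents above `e` but not at `e`. This means that two coefficient maps have different ranks, and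
each rank is generically constant. -/
lemma exists_isGeneric_mem_leadExps [Infinite K] {J : Ideal (Poly K n m)} (hJ : IsBigraded J)
    (e : Fin n ⊕ Fin m →₀ ℕ) :
    ∃ t : Prop, IsGeneric fun g => e ∈ leadExps (J.map (act g)) ↔ t := by
  classical
  set d := Finsupp.weight (wt n m) e with hd
  let T₂ := (exponents n m d).filter fun e' => RevLexLT e e'
  let T₁ := insert e T₂
  obtain ⟨ρ₁, h₁⟩ := exists_isGeneric_finrank_coeffMap J d T₁
  obtain ⟨ρ₂, h₂⟩ := exists_isGeneric_finrank_coeffMap J d T₂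
  refine ⟨ρ₁ ≠ ρ₂, (h₁.and h₂).mono ?_⟩
  rintro g ⟨hg₁, hg₂⟩
  have hr₁ := (coeffMap J d T₁ g).finrank_range_add_finrank_ker
  have hr₂ := (coeffMap J d T₂ g).finrank_range_add_finrank_ker
  have hle : LinearMap.ker (coeffMap J d T₁ g) ≤ LinearMap.ker (coeffMap J d T₂ g) :=
    fun f hf => mem_ker_coeffMap.2 fun t ht =>
      mem_ker_coeffMap.1 hf t (Finset.mem_insert_of_mem ht)
  have hker : ρ₁ = ρ₂ ↔
      LinearMap.ker (coeffMap J d T₁ g) = LinearMap.ker (coeffMap J d T₂ g) := by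
    constructor
    · intro h
      exact Submodule.eq_of_le_of_finrank_eq hle (by omega)
    · intro h
      rw [h] at hr₁
      omega
  rw [Ne, hker, mem_leadExps_iff (isBigraded_map_act hJ g), ← hd, part_map_act]
  constructor
  · rintro ⟨_, ⟨f, hf, rfl⟩, he, h⟩ heq
    have h2 : (⟨f, hf⟩ : part J d) ∈ LinearMap.ker (coeffMap J d T₂ g) := by
      refine mem_ker_coeffMap.2 fun t ht => ?_
      by_contra hne
      have hlt := (Finset.mem_filter.1 ht).2
      refine RevLexLT.irrefl e (hlt.trans (h t (MvPolynomial.mem_support_iff.2 hne) ?_))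
      rintro rfl
      exact RevLexLT.irrefl _ hlt
    rw [← heq] at h2
    exact MvPolynomial.mem_support_iff.1 he (mem_ker_coeffMap.1 h2 e (Finset.mem_insert_self _ _))
  · intro hne
    obtain ⟨f, hf₂, hf₁⟩ := SetLike.exists_of_lt (lt_of_le_of_ne hle hne)
    rw [mem_ker_coeffMap] at hf₁ hf₂
    refine ⟨act g f.1, ⟨f.1, f.2, rfl⟩, ?_, fun e' he' hne' => ?_⟩
    · rw [MvPolynomial.mem_support_iff]
      intro h0
      refine hf₁ fun t ht => ?_
      rcases Finset.mem_insert.1 ht with rfl | ht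
      · exact h0
      · exact hf₂ t ht
    · refine (revLexLT_or hne').resolve_right fun hlt => ?_
      rw [MvPolynomial.mem_support_iff] at he'
      exact he' (hf₂ e' (Finset.mem_filter.2
        ⟨mem_exponents.2 (isBihom_act f.2.2 g he'), hlt⟩))

theorem exists_isBigin [Infinite K] {J : Ideal (Poly K n m)} (hJ : IsBigraded J) :
    ∃ B, IsBigin J B := by
  classical
  choose t ht using exists_isGeneric_mem_leadExps hJ
  let E : Set (Fin n ⊕ Fin m →₀ ℕ) := {e | t e}
  -- Membership is generic for each exponent separately, but only finitely many open conditions can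
  -- be imposed together; by noetherianity finitely many exponents `E₀` generate all of `E`.
  obtain ⟨T, hTE, hT⟩ := (Submodule.fg_span_iff_fg_span_finset_subset
    ((fun e => MvPolynomial.monomial e (1 : K)) '' E : Set (Poly K n m))).1
    (IsNoetherian.noetherian (Submodule.span (Poly K n m) _))
  obtain ⟨E₀, hE₀, rfl⟩ := Finset.subset_set_image_iff.1 hTE
  have hE : ∀ e ∈ E, ∃ e₀ ∈ E₀, e₀ ≤ e := by
    intro e he
    have h1 : (MvPolynomial.monomial e (1 : K) : Poly K n m) ∈
        Ideal.span ((fun e => MvPolynomial.monomial e (1 : K)) '' (E₀ : Set _)) := by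
      rw [← Finset.coe_image]
      exact hT.le (Submodule.subset_span ⟨e, he, rfl⟩)
    rw [MvPolynomial.mem_ideal_span_monomial_image] at h1
    simpa using h1 e (by simp)
  obtain ⟨P, ⟨g₀, hg₀⟩, hP⟩ := IsGeneric.forall_finset ht E₀
  refine ⟨Ideal.span ((fun e => MvPolynomial.monomial e (1 : K)) '' E),
    {g | MvPolynomial.eval (entries g) P ≠ 0}, ⟨{P}, by simp⟩, ⟨g₀, hg₀⟩, fun g hg => ?_⟩
  rw [initialIdeal_eq]
  congr 2
  have hsub : E ⊆ leadExps (J.map (act g)) := by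
    intro e he
    obtain ⟨e₀, he₀, hle⟩ := hE e he
    rw [← add_tsub_cancel_of_le hle]
    exact leadExps_add (isBigraded_map_act hJ g) ((hP g hg e₀ he₀).2 (hE₀ he₀)) _
  refine (Set.Subset.antisymm hsub fun e he => ?_).symm
  set d := Finsupp.weight (wt n m) e with hd
  -- In bidegree `d` the set `E` has `dim J_d` elements, as an auxiliary `g'` generic for all
  -- exponents of that bidegree shows. The same number counts the leading exponents of `gJ`, so the
  -- inclusion `hsub` is an equality.
  obtain ⟨g', hg'⟩ := (IsGeneric.forall_finset ht (exponents n m d)).exists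
  have h1 := finrank_part (isBigraded_map_act hJ g) d
  have h2 := finrank_part (isBigraded_map_act hJ g') d
  rw [finrank_part_map_act] at h1 h2
  have h3 : (exponents n m d).filter (· ∈ leadExps (J.map (act g'))) =
      (exponents n m d).filter (· ∈ E) :=
    Finset.filter_congr hg'
  have h4 : (exponents n m d).filter (· ∈ E) =
      (exponents n m d).filter (· ∈ leadExps (J.map (act g))) := by
    refine Finset.eq_of_subset_of_card_le (Finset.monotone_filter_right _ fun a _ ha => hsub ha) ?_
    rw [← h1, ← h3, ← h2]
  have h5 : e ∈ (exponents n m d).filter (· ∈ E) := by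
    rw [h4]
    exact Finset.mem_filter.2 ⟨mem_exponents.2 rfl, he⟩
  exact (Finset.mem_filter.1 h5).2

/-! ### Linear forms which are almost regular -/

/-- The ideal `(x_1, …, x_n)`. -/
noncomputable def xIdeal (K : Type u) [Field K] (n m : ℕ) : Ideal (Poly K n m) :=
  Ideal.span (Set.range fun i : Fin n => MvPolynomial.X (Sum.inl i))

/-- The linear form `∑ v_i x_i`. -/
noncomputable def xForm (m : ℕ) : (Fin n → K) →ₗ[K] Poly K n m where
  toFun v := ∑ i, MvPolynomial.C (v i) * MvPolynomial.X (Sum.inl i)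
  map_add' v w := by simp [add_mul, Finset.sum_add_distrib]
  map_smul' c v := by simp [MvPolynomial.smul_eq_C_mul, Finset.mul_sum, mul_assoc]

lemma xForm_apply (v : Fin n → K) :
    xForm m v = ∑ i, MvPolynomial.C (v i) * MvPolynomial.X (Sum.inl i) := rfl

lemma xForm_single (i : Fin n) :
    xForm (K := K) m (Pi.single i 1) = MvPolynomial.X (Sum.inl i) := by
  rw [xForm_apply, Finset.sum_eq_single i] <;> simp +contextual

lemma isBihom_xForm (v : Fin n → K) : IsBihom (xForm m v) (1, 0) := by
  rw [xForm_apply]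
  refine MvPolynomial.IsWeightedHomogeneous.sum _ _ _ fun i _ => ?_
  have := (isBihom_C (n := n) (m := m) (v i)).mul (isBihom_X (K := K) (Sum.inl i))
  rwa [zero_add] at this

lemma monomial_mem_xIdeal_pow {N : ℕ} {e : Fin n ⊕ Fin m →₀ ℕ} (he : N ≤ xdeg e) (r : K) :
    MvPolynomial.monomial e r ∈ xIdeal K n m ^ N := by
  rw [MvPolynomial.monomial_eq, Finsupp.prod_fintype _ _ (by simp), Fintype.prod_sum_type]
  refine Ideal.mul_mem_left _ _ (Ideal.mul_mem_right _ _ (Ideal.pow_le_pow_right he ?_))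
  rw [xdeg, ← Finset.prod_pow_eq_pow_sum]
  refine Ideal.prod_mem_prod fun i _ => Ideal.pow_mem_pow ?_ _
  exact Ideal.subset_span ⟨i, rfl⟩

/-- The saturation of an ideal with respect to `(x_1, …, x_n)`. -/
lemma exists_saturation (I : Ideal (Poly K n m)) :
    ∃ (Q : Ideal (Poly K n m)) (N : ℕ), I ≤ Q ∧ (∀ q ∈ Q, ∀ s ∈ xIdeal K n m ^ N, q * s ∈ I) ∧
      ∀ p, (∀ i, MvPolynomial.X (Sum.inl i) * p ∈ Q) → p ∈ Q := by
  let c : ℕ →o Ideal (Poly K n m) :=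
    ⟨fun k => Submodule.colon I (xIdeal K n m ^ k : Ideal (Poly K n m)), fun k l hkl q hq =>
      Submodule.mem_colon.2 fun s hs =>
        Submodule.mem_colon.1 hq s (Ideal.pow_le_pow_right hkl hs)⟩
  -- The ascending chain of colon ideals `I : (x_1, …, x_n)^k` becomes stationary; its final value
  -- is the saturation.
  obtain ⟨N, hN⟩ := monotone_stabilizes_iff_noetherian.2
    (inferInstance : IsNoetherian (Poly K n m) (Poly K n m)) c
  have hc : ∀ k q, q ∈ c k ↔ ∀ s ∈ xIdeal K n m ^ k, q * s ∈ I := fun k q =>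
    Submodule.mem_colon
  refine ⟨c N, N, fun q hq => (hc _ _).2 fun s _ => I.mul_mem_right _ hq,
    fun q hq => (hc _ _).1 hq, fun p hp => ?_⟩
  rw [hN (N + 1) (Nat.le_succ N), hc]
  have hx : xIdeal K n m ≤ Submodule.colon (c N) ({p} : Set (Poly K n m)) := by
    refine Ideal.span_le.2 ?_
    rintro _ ⟨i, rfl⟩
    exact Submodule.mem_colon_singleton.2 (hp i)
  have hle : xIdeal K n m ^ (N + 1) ≤ Submodule.colon I ({p} : Set (Poly K n m)) := by
    rw [pow_succ']
    refine Ideal.mul_le.2 fun x hxx s hs => Submodule.mem_colon_singleton.2 ?_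
    have h1 := (hc _ _).1 (Submodule.mem_colon_singleton.1 (hx hxx)) s hs
    rw [smul_eq_mul] at h1 ⊢
    rwa [show x * s * p = x * p * s by ring]
  intro s hs
  rw [mul_comm]
  exact Submodule.mem_colon_singleton.1 (hle hs)

/-- The elements of large `x`-degree of the saturation of `I` are in `I`. -/
lemma exists_bound_of_mul_mem {I Q : Ideal (Poly K n m)} (hI : IsBigraded I) {N : ℕ}
    (hQ : ∀ q ∈ Q, ∀ s ∈ xIdeal K n m ^ N, q * s ∈ I) :
    ∃ c : ℤ, ∀ a > c, ∀ b p, IsBihom p (a, b) → p ∈ Q → p ∈ I := by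
  classical
  obtain ⟨G, hG⟩ : Q.FG := IsNoetherian.noetherian Q
  let c : ℕ := G.sup fun g => g.support.sup xdeg
  have hcg : ∀ g ∈ G, ∀ e ∈ g.support, xdeg e ≤ c := fun g hg e he =>
    (Finset.le_sup (f := xdeg) he).trans (Finset.le_sup (f := fun g => g.support.sup xdeg) hg)
  -- Modulo `I`, every element of `Q` is represented in `x`-degrees at most `N + c`: a monomial of
  -- `x`-degree at least `N` multiplies the generators of `Q` into `I`, and the other multiples stay
  -- below the bound.
  let Good : Poly K n m → Prop := fun q => ∃ q' ∈ I, ∀ e ∈ (q - q').support, xdeg e ≤ N + c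
  have hadd : ∀ p q, Good p → Good q → Good (p + q) := by
    rintro p q ⟨p', hp', hp⟩ ⟨q', hq', hq⟩
    refine ⟨p' + q', I.add_mem hp' hq', fun e he => ?_⟩
    rw [add_sub_add_comm] at he
    exact (Finset.mem_union.1 (MvPolynomial.support_add he)).elim (hp e) (hq e)
  have hgood : ∀ q ∈ Q, ∀ r, Good (r * q) := by
    intro q hq
    rw [← hG] at hq
    induction hq using Submodule.span_induction with
    | mem g hg =>
      have hgQ : g ∈ Q := hG ▸ Submodule.subset_span hg
      intro r
      induction r using MvPolynomial.induction_on' with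
      | monomial e a =>
        by_cases he : N ≤ xdeg e
        · refine ⟨MvPolynomial.monomial e a * g, ?_, by simp⟩
          rw [mul_comm]
          exact hQ g hgQ _ (monomial_mem_xIdeal_pow he a)
        · refine ⟨0, I.zero_mem, fun f hf => ?_⟩
          rw [sub_zero] at hf
          obtain ⟨e', he', f', hf', rfl⟩ := Finset.mem_add.1 (MvPolynomial.support_mul _ _ hf)
          have h1 := Finset.mem_singleton.1 (MvPolynomial.support_monomial_subset he')
          have h2 := hcg g hg f' hf'
          have h3 : xdeg (e' + f') = xdeg e' + xdeg f' := by
            simp [xdeg, Finset.sum_add_distrib]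
          rw [h3, h1]
          omega
      | add p q hp hq =>
        rw [add_mul]
        exact hadd _ _ hp hq
    | zero => exact fun r => ⟨0, I.zero_mem, by simp⟩
    | add p q _ _ hp hq =>
      intro r
      rw [mul_add]
      exact hadd _ _ (hp r) (hq r)
    | smul s q _ hq =>
      intro r
      rw [smul_eq_mul, ← mul_assoc]
      exact hq _
  refine ⟨N + c, fun a ha b p hp hpQ => ?_⟩
  obtain ⟨p', hp', h⟩ := hgood p hpQ 1
  rw [one_mul] at h
  have h0 : bicomp (a, b) (p - p') = 0 := by
    ext e
    by_contra hne
    have h1 := isBihom_bicomp _ _ hne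
    have h2 := h e (support_bicomp_subset _ _ (MvPolynomial.mem_support_iff.2 hne))
    rw [weight_eq, Prod.mk.injEq] at h1
    omega
  rw [map_sub, hp.bicomp_eq, sub_eq_zero] at h0
  rw [h0]
  exact hI _ hp' _

/-- A general linear form in the `x_i` is almost regular on `S/I`. -/
lemma exists_poly_almost_regular {I : Ideal (Poly K n m)} (hI : IsBigraded I) :
    ∃ Λ : MvPolynomial (Fin n) K, Λ ≠ 0 ∧ ∀ v, MvPolynomial.eval v Λ ≠ 0 →
      ∃ c : ℤ, ∀ a > c, ∀ b p, IsBihom p (a, b) → xForm m v * p ∈ I → p ∈ I := by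
  classical
  obtain ⟨Q, N, hIQ, hQ, hsat⟩ := exists_saturation I
  obtain ⟨c, hc⟩ := exists_bound_of_mul_mem hI hQ
  have hfin : (associatedPrimes (Poly K n m) (Poly K n m ⧸ Q)).Finite :=
    associatedPrimes.finite _ _
  have hL : ∀ P ∈ associatedPrimes (Poly K n m) (Poly K n m ⧸ Q),
      ∃ f : (Fin n → K) →ₗ[K] K, f ≠ 0 ∧ ∀ v, xForm m v ∈ P → f v = 0 := by
    intro P hP
    -- The linear forms lying in the associated prime `P`. They form a proper subspace, since a
    -- prime containing all `x_i` would annihilate the class of some `p ∉ Q`, contrary to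
    -- saturation.
    let L : Submodule K (Fin n → K) := (P.restrictScalars K).comap (xForm m)
    have hLtop : L < ⊤ := by
      refine lt_top_iff_ne_top.2 fun htop => ?_
      obtain ⟨hprime, x, hx⟩ := isAssociatedPrime_iff.1 hP
      obtain ⟨p, rfl⟩ := Submodule.mkQ_surjective Q x
      refine hprime.ne_top ((Ideal.eq_top_iff_one _).2 ?_)
      rw [hx, Submodule.mem_colon_singleton, one_smul, Submodule.mem_bot, Submodule.mkQ_apply,
        Submodule.Quotient.mk_eq_zero]
      refine hsat p fun i => ?_
      have h1 : xForm m (Pi.single i 1) ∈ P :=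
        (htop ▸ Submodule.mem_top : (Pi.single i 1 : Fin n → K) ∈ L)
      rw [xForm_single, hx, Submodule.mem_colon_singleton, Submodule.mem_bot, ← map_smul,
        Submodule.mkQ_apply, Submodule.Quotient.mk_eq_zero] at h1
      exact h1
    obtain ⟨f, hf, hle⟩ := Submodule.exists_le_ker_of_lt_top L hLtop
    exact ⟨f, hf, fun v hv => hle hv⟩
  choose! f hf0 hf using hL
  let lin : Ideal (Poly K n m) → MvPolynomial (Fin n) K := fun P =>
    ∑ i, MvPolynomial.C (f P (Pi.single i 1)) * MvPolynomial.X i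
  have hlin : ∀ P v, MvPolynomial.eval v (lin P) = f P v := by
    intro P v
    have h1 : v = ∑ i, v i • (Pi.single i 1 : Fin n → K) := by
      funext s
      simp [Finset.sum_apply, Pi.single_apply]
    conv_rhs => rw [h1, map_sum]
    simp [lin, mul_comm]
  refine ⟨∏ P ∈ hfin.toFinset, lin P, Finset.prod_ne_zero_iff.2 fun P hP h0 => ?_, ?_⟩
  · refine hf0 P (hfin.mem_toFinset.1 hP) (LinearMap.ext fun v => ?_)
    rw [← hlin, h0, map_zero, LinearMap.zero_apply]
  · intro v hv
    -- A form outside all associated primes is a nonzerodivisor on `S/Q`, and above `x`-degree `c`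
    -- membership in `Q` implies membership in `I`.
    refine ⟨c, fun a ha b p hp hzp => hc a ha b p hp ?_⟩
    by_contra hpQ
    have hx : Submodule.mkQ Q p ≠ 0 := by
      rwa [Ne, Submodule.mkQ_apply, Submodule.Quotient.mk_eq_zero]
    obtain ⟨P, hP, hle⟩ := exists_le_isAssociatedPrime_of_isNoetherianRing (Poly K n m) _ hx
    have hmem : xForm m v ∈ P := by
      refine hle (Submodule.mem_colon_singleton.2 ?_)
      rw [Submodule.mem_bot, ← map_smul, Submodule.mkQ_apply, Submodule.Quotient.mk_eq_zero]
      exact hIQ hzp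
    rw [map_prod, Finset.prod_ne_zero_iff] at hv
    exact hv P (hfin.mem_toFinset.2 hP) (by rw [hlin, hf P hP v hmem])

/-! ### Almost regular sequences -/

/-- The linear form with the coefficients in the column of `a` which belongs to the `k`-th element
of `x_n, …, x_1`. -/
noncomputable def colForm (a : (Fin n × Fin n) ⊕ (Fin m × Fin m) → K) (k : ℕ) : Poly K n m :=
  if h : k < n then xForm m fun i => a (Sum.inl (i, Fin.rev ⟨k, h⟩)) else 0

/-- The ideal generated by the first `k` of these linear forms. -/
noncomputable def colIdeal (a : (Fin n × Fin n) ⊕ (Fin m × Fin m) → K) (k : ℕ) :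
    Ideal (Poly K n m) :=
  Ideal.span (colForm a '' Set.Iio k)

lemma colIdeal_succ (a : (Fin n × Fin n) ⊕ (Fin m × Fin m) → K) (k : ℕ) :
    colIdeal a (k + 1) = colIdeal a k ⊔ Ideal.span {colForm a k} := by
  rw [colIdeal, colIdeal, ← Set.image_singleton, ← Ideal.span_union, ← Set.image_union]
  congr 2
  ext i
  simp

lemma isBihom_colForm (a : (Fin n × Fin n) ⊕ (Fin m × Fin m) → K) (k : ℕ) :
    IsBihom (colForm a k) (1, 0) := by
  unfold colForm
  split_ifs with h
  · exact isBihom_xForm _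
  · exact MvPolynomial.isWeightedHomogeneous_zero _ _ _

lemma isBigraded_colIdeal (a : (Fin n × Fin n) ⊕ (Fin m × Fin m) → K) :
    ∀ k, IsBigraded (colIdeal a k)
  | 0 => by
    have : colIdeal a 0 = ⊥ := by simp [colIdeal]
    rw [this]
    exact isBigraded_bot
  | k + 1 => by
    rw [colIdeal_succ]
    exact (isBigraded_colIdeal a k).sup (isBigraded_span_singleton (isBihom_colForm a k))

lemma act_varSeq (h : Grp K n m) {k : ℕ} (hk : k < n) :
    act h (varSeq K n m k) = colForm (entries h) k := by
  rw [colForm, dif_pos hk, ← congrArg (varSeq K n m) (varIdx_rev (m := m) hk), varSeq_varIdx,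
    act_X_inl]
  rfl

lemma map_varIdeal (h : Grp K n m) {k : ℕ} (hk : k ≤ n) :
    (varIdeal K n m k).map (act h) = colIdeal (entries h) k := by
  induction k with
  | zero => simp [varIdeal, colIdeal]
  | succ k ih =>
    rw [isLinearSystem_varSeq.succ k (by omega), Ideal.map_sup, ih (by omega), colIdeal_succ,
      Ideal.map_span, Set.image_singleton, act_varSeq h hk]

/-- The columns are chosen one after another. The condition on the `l`-th form involves only this
form and its predecessors, so a later column can be replaced without harm, while keeping `P` nonzero
at the matrix. A single good point where `P ≠ 0` suffices. -/
lemma exists_almost_regular [Infinite K] {J : Ideal (Poly K n m)} (hJ : IsBigraded J)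
    {P : MvPolynomial ((Fin n × Fin n) ⊕ (Fin m × Fin m)) K} (hP : P ≠ 0) :
    ∀ k ≤ n, ∃ a, MvPolynomial.eval a P ≠ 0 ∧ ∀ l < k, ∃ c : ℤ, ∀ r > c, ∀ b p,
      IsBihom p (r, b) → colForm a l * p ∈ J ⊔ colIdeal a l → p ∈ J ⊔ colIdeal a l := by
  classical
  intro k
  induction k with
  | zero =>
    intro _
    obtain ⟨a, ha⟩ : ∃ a, MvPolynomial.eval a P ≠ 0 := by
      by_contra! h
      exact hP (MvPolynomial.funext fun a => by rw [h a, map_zero])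
    exact ⟨a, ha, by simp⟩
  | succ k ih =>
    intro hk
    obtain ⟨a, ha, hreg⟩ := ih (by omega)
    obtain ⟨Λ, hΛ, hΛ'⟩ := exists_poly_almost_regular (hJ.sup (isBigraded_colIdeal a k))
    let col : Fin n := Fin.rev ⟨k, hk⟩
    let upd : (Fin n → K) → (Fin n × Fin n) ⊕ (Fin m × Fin m) → K := fun v =>
      Sum.elim (fun ij => if ij.2 = col then v ij.1 else a (Sum.inl ij)) fun kl => a (Sum.inr kl)
    -- `P` with the entries of the new column left as indeterminates and all other entries fixed; it
    -- is nonzero because the old column gives a nonzero value.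
    let P' : MvPolynomial (Fin n) K := MvPolynomial.aeval (Sum.elim
      (fun ij => if ij.2 = col then MvPolynomial.X ij.1 else MvPolynomial.C (a (Sum.inl ij)))
      fun kl => MvPolynomial.C (a (Sum.inr kl))) P
    have hP' : ∀ v, MvPolynomial.eval v P' = MvPolynomial.eval (upd v) P := by
      intro v
      have h : (MvPolynomial.eval v).comp (MvPolynomial.aeval (R := K) (Sum.elim
          (fun ij => if ij.2 = col then MvPolynomial.X ij.1 else MvPolynomial.C (a (Sum.inl ij)))
          fun kl => MvPolynomial.C (a (Sum.inr kl)))).toRingHom = MvPolynomial.eval (upd v) := by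
        refine MvPolynomial.ringHom_ext (fun c => by simp) fun w => ?_
        rcases w with ⟨i, j⟩ | w
        · by_cases hj : j = col <;> simp [upd, hj]
        · simp [upd]
      exact RingHom.congr_fun h P
    have hupd : upd (fun i => a (Sum.inl (i, col))) = a := by
      funext w
      rcases w with ⟨i, j⟩ | w
      · by_cases hj : j = col <;> simp [upd, hj]
      · rfl
    have hP0 : P' ≠ 0 := by
      intro h0
      have := hP' fun i => a (Sum.inl (i, col))
      rw [hupd, h0, map_zero] at this
      exact ha this.symm
    obtain ⟨v, hv⟩ : ∃ v, MvPolynomial.eval v (Λ * P') ≠ 0 := by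
      by_contra! h
      exact mul_ne_zero hΛ hP0 (MvPolynomial.funext fun a => by rw [h a, map_zero])
    rw [map_mul] at hv
    have hform : ∀ l < k, colForm (upd v) l = colForm a l := by
      intro l hl
      have hne : Fin.rev (⟨l, by omega⟩ : Fin n) ≠ col := by
        intro h
        have := congrArg Fin.val (Fin.rev_injective h)
        simp only at this
        omega
      simp [colForm, show l < n by omega, upd, hne]
    have hideal : ∀ l ≤ k, colIdeal (upd v) l = colIdeal a l := by
      intro l hl
      unfold colIdeal
      congr 1
      exact Set.image_congr fun i hi => hform i (lt_of_lt_of_le hi hl)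
    refine ⟨upd v, ?_, fun l hl => ?_⟩
    · rw [← hP']
      exact right_ne_zero_of_mul hv
    · rcases Nat.lt_succ_iff_lt_or_eq.1 hl with hl | rfl
      · rw [hform l hl, hideal l hl.le]
        exact hreg l hl
      · rw [hideal l le_rfl]
        have : colForm (upd v) l = xForm m v := by
          simp [colForm, show l < n by omega, upd, col]
        rw [this]
        exact hΛ' v (left_ne_zero_of_mul hv)

/-- Multiplying `P` by the determinants makes the matrix of `exists_almost_regular` invertible. -/
lemma exists_bddAbove_jumps [Infinite K] {J : Ideal (Poly K n m)} (hJ : IsBigraded J)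
    {P : MvPolynomial ((Fin n × Fin n) ⊕ (Fin m × Fin m)) K} (hP : P ≠ 0) :
    ∃ h : Grp K n m, MvPolynomial.eval (entries h) P ≠ 0 ∧
      BddAbove (jumps (fun k => act h (varSeq K n m k)) (fun k => (varIdeal K n m k).map (act h))
        J) := by
  have hdet : detPoly K n m ≠ 0 := fun h =>
    eval_detPoly_ne_zero (1 : Grp K n m) (by rw [h, map_zero])
  obtain ⟨a, ha, hreg⟩ := exists_almost_regular hJ (mul_ne_zero hP hdet) n le_rfl
  rw [map_mul] at ha
  obtain ⟨h, rfl⟩ := exists_entries_eq (right_ne_zero_of_mul ha)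
  refine ⟨h, left_ne_zero_of_mul ha, ?_⟩
  choose! c hc using hreg
  obtain ⟨C, hC⟩ := ((Set.finite_Iio n).image c).bddAbove
  -- The bound 0 serves `S/(J + Q_n)`, as `Q_n` is the image of `(x_1, …, x_n)` and contains
  -- everything of positive `x`-degree; `C` bounds the kernels of the `n` forms.
  refine ⟨max 0 C, ?_⟩
  rintro r ⟨b, ⟨p, hp, hpn⟩ | ⟨k, hk, p, hp, hzp, hpn⟩⟩
  · refine le_max_of_le_left ?_
    by_contra! hr
    refine hpn (Submodule.mem_sup_right ?_)
    rw [mem_map_act, varIdeal, MvPolynomial.mem_ideal_span_X_image]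
    intro e he
    have hw := isBihom_act hp h⁻¹ (MvPolynomial.mem_support_iff.1 he)
    rw [weight_eq, Prod.mk.injEq] at hw
    have hx : xdeg e ≠ 0 := by omega
    obtain ⟨i, -, hi⟩ := Finset.exists_ne_zero_of_sum_ne_zero hx
    refine ⟨Sum.inl i, ?_, hi⟩
    simp only [varIdx, Sum.elim_inl, Set.mem_ofPred_eq]
    omega
  · refine le_max_of_le_right ?_
    by_contra! hr
    simp only [act_varSeq h hk, map_varIdeal h hk.le] at hzp hpn
    exact hpn (hc k hk r (lt_of_le_of_lt (hC ⟨k, hk, rfl⟩) hr) b p hp hzp)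

/-! ### The inverse of a generic element -/

lemma eval_adjugate_X {ι : Type*} {r : ℕ} (a : ι → K) (s : Fin r × Fin r → ι) (i j : Fin r) :
    MvPolynomial.eval a ((Matrix.of fun i j => MvPolynomial.X (s (i, j))).adjugate i j) =
      (Matrix.of fun i j => a (s (i, j))).adjugate i j := by
  have h := congrFun (congrFun (RingHom.map_adjugate (MvPolynomial.eval a)
    (Matrix.of fun i j => MvPolynomial.X (s (i, j)))) i) j
  rw [RingHom.mapMatrix_apply, Matrix.map_apply] at h
  rw [h]
  congr 2
  ext i j
  simp

lemma eval_det_X {ι : Type*} {r : ℕ} (a : ι → K) (s : Fin r × Fin r → ι) :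
    MvPolynomial.eval a (Matrix.of fun i j => MvPolynomial.X (s (i, j))).det =
      (Matrix.of fun i j => a (s (i, j))).det := by
  rw [RingHom.map_det]
  congr 1
  ext i j
  simp

/-- Almost regularity concerns `g⁻¹`, whereas the open set of `bigin` is given by equations in `g`.
Clearing denominators in the adjugate formula turns one kind of condition into the other. -/
lemma exists_poly_entries_inv (P : MvPolynomial ((Fin n × Fin n) ⊕ (Fin m × Fin m)) K) :
    ∃ (P' : MvPolynomial ((Fin n × Fin n) ⊕ (Fin m × Fin m)) K) (N : ℕ), ∀ g : Grp K n m,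
      MvPolynomial.eval (entries g) P' =
        MvPolynomial.eval (entries g) (detPoly K n m) ^ N * MvPolynomial.eval (entries g⁻¹) P := by
  induction P using MvPolynomial.induction_on with
  | C c => exact ⟨MvPolynomial.C c, 0, fun g => by simp⟩
  | add p q hp hq =>
    obtain ⟨p', k, hp⟩ := hp
    obtain ⟨q', l, hq⟩ := hq
    refine ⟨detPoly K n m ^ l * p' + detPoly K n m ^ k * q', k + l, fun g => ?_⟩
    simp only [map_add, map_mul, map_pow, hp, hq]
    ring
  | mul_X p v hp =>
    obtain ⟨p', k, hp⟩ := hp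
    have hv : ∃ A : MvPolynomial ((Fin n × Fin n) ⊕ (Fin m × Fin m)) K, ∀ g : Grp K n m,
        MvPolynomial.eval (entries g) A =
          MvPolynomial.eval (entries g) (detPoly K n m) * entries g⁻¹ v := by
      have h0 : ∀ g : Grp K n m, g.1.1.det ≠ 0 ∧ g.2.1.det ≠ 0 := fun g =>
        ⟨g.1.det_ne_zero, g.2.det_ne_zero⟩
      rcases v with ⟨i, j⟩ | ⟨i, j⟩
      · refine ⟨(Matrix.of fun i j => MvPolynomial.X (Sum.inl (i, j))).adjugate i j *
          (Matrix.of fun i j => MvPolynomial.X (Sum.inr (i, j))).det, fun g => ?_⟩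
        have h1 : entries g⁻¹ (Sum.inl (i, j)) = g.1.1.det⁻¹ * g.1.1.adjugate i j := by
          simp [entries, Matrix.coe_units_inv, Matrix.inv_def]
        rw [map_mul, eval_adjugate_X _ Sum.inl, eval_det_X _ Sum.inr, h1, eval_detPoly_entries]
        change g.1.1.adjugate i j * g.2.1.det = _
        field_simp [h0 g]
      · refine ⟨(Matrix.of fun i j => MvPolynomial.X (Sum.inr (i, j))).adjugate i j *
          (Matrix.of fun i j => MvPolynomial.X (Sum.inl (i, j))).det, fun g => ?_⟩
        have h1 : entries g⁻¹ (Sum.inr (i, j)) = g.2.1.det⁻¹ * g.2.1.adjugate i j := by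
          simp [entries, Matrix.coe_units_inv, Matrix.inv_def]
        rw [map_mul, eval_adjugate_X _ Sum.inr, eval_det_X _ Sum.inl, h1, eval_detPoly_entries]
        change g.2.1.adjugate i j * g.1.1.det = _
        field_simp [h0 g]
    obtain ⟨A, hA⟩ := hv
    refine ⟨p' * A, k + 1, fun g => ?_⟩
    simp only [map_mul, hp, hA, MvPolynomial.eval_X]
    ring

theorem regX_eq_regX_bigin [Infinite K] {J : Ideal (Poly K n m)} (hJ : IsBigraded J) :
    regX J = regX (bigin J) := by
  obtain ⟨U, ⟨Ps, rfl⟩, ⟨g₀, P, hP, hg₀⟩, hB⟩ : IsBigin J (bigin J) :=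
    Classical.epsilon_spec (exists_isBigin hJ)
  obtain ⟨P', N, hP'⟩ := exists_poly_entries_inv P
  have hP0 : P' ≠ 0 := by
    rintro rfl
    have h := hP' g₀⁻¹
    rw [inv_inv, map_zero] at h
    exact mul_ne_zero (pow_ne_zero N (eval_detPoly_ne_zero g₀⁻¹)) hg₀ h.symm
  obtain ⟨h, hh, hbdd⟩ := exists_bddAbove_jumps hJ hP0
  rw [hP'] at hh
  -- The element `h` moves the coordinate sequence to almost regular forms on `J`, so its inverse is
  -- the coordinate change to be applied to `J`; the nonvanishing of `P'` at `h` puts this inverse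
  -- in the open set of `bigin`.
  obtain ⟨g, rfl⟩ : ∃ g : Grp K n m, h = g⁻¹ := ⟨h⁻¹, (inv_inv h).symm⟩
  rw [inv_inv] at hh
  have hg := hB g ⟨P, hP, right_ne_zero_of_mul hh⟩
  have hI := isBigraded_map_act hJ g
  have hz := isLinearSystem_varSeq (K := K) (n := n) (m := m)
  have hjumps : jumps (varSeq K n m) (varIdeal K n m) (initialIdeal (J.map (act g))) =
      jumps (fun k => act g⁻¹ (varSeq K n m k)) (fun k => (varIdeal K n m k).map (act g⁻¹)) J := by
    rw [jumps_initialIdeal hI, jumps_act]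
  rw [← hg, regX_eq_sSup_jumps hJ (hz.act_inv g) hbdd,
    regX_eq_sSup_jumps (isBigraded_initialIdeal hI) hz (hjumps ▸ hbdd), hjumps]

end Bigraded

theorem proposition4p2 {K : Type*} [Field K] [CharZero K] (n m : ℕ)
    (J : Ideal (Bigraded.Poly K n m)) (hJ : Bigraded.IsBigraded J) :
    Bigraded.regX J = Bigraded.regX (Bigraded.bigin J) := by
  -- Characteristic zero enters through the infinitude of `K`.
  exact Bigraded.regX_eq_regX_bigin hJ
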